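/- Let $\mathbf{RP}^1$ be the real projective line, with the angular parameter $x\mapsto[\cos x:\sin x]$, so that $x$ and $x+\pi$ describe the same point and smoothness and orientation on $\mathbf{RP}^1$ are those of $\mathbf R/\pi\mathbf Z$. For a diffeomorphism $g$ of $\mathbf{RP}^1$, the quadratic differential $$\left(\frac{h'''}{h'}-\frac32\Big(\frac{h''}{h'}\Big)^2\right)dt^2,$$ where $h$ is the expression of $g$ in affine coordinates (with affine coordinate $t$ on the source), does not depend on the choice of the affine coordinates; let the Schwarzian derivative $S(g)$ be the function on $\mathbf{RP}^1$ for which this quadratic differential equals $S(g)\,dx^2$, with $x$ the angular parameter. Let $f:\mathbf{RP}^1\to\mathbf R$ be a smooth function with at least four sign changes, that is, there are $x_1<x_2<x_3<x_4<x_1+\pi$ at which $f$ is positive, negative, positive, negative, respectively. Then there exist orientation preserving diffeomorphisms $\varphi$ and $g$ of $\mathbf{RP}^1$ such that $\varphi^*(f)=S(g)$, that is, $f(\varphi(p))=S(g)(p)$ for all $p\in\mathbf{RP}^1$. -/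

import Mathlib

open scoped ContDiff

namespace ConverseGhys

noncomputable section

/-- The real projective line: the lines through the origin of `ℝ²`. -/
abbrev RP1 : Type := Projectivization ℝ (Fin 2 → ℝ)

theorem angle_ne_zero (x : ℝ) : (![Real.cos x, Real.sin x] : Fin 2 → ℝ) ≠ 0 := by
  intro h
  have h0 : Real.cos x = 0 := congrFun h 0
  have h1 : Real.sin x = 0 := congrFun h 1
  have := Real.sin_sq_add_cos_sq x
  rw [h0, h1] at this
  norm_num at this

/-- The angular parametrization `x ↦ [cos x : sin x]` of the projective line. It identifies `RP1`
with `ℝ / πℤ` (as a set, and by definition as an oriented smooth manifold). -/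
def angle (x : ℝ) : RP1 := Projectivization.mk ℝ ![Real.cos x, Real.sin x] (angle_ne_zero x)

/-- A real function on the projective line is smooth if it is smooth in the angular parameter. -/
def IsSmooth (f : RP1 → ℝ) : Prop := ContDiff ℝ ∞ (fun x : ℝ => f (angle x))

/-- `f` has at least four sign changes: going once around the projective line one meets, in this
cyclic order, four points at which `f` is positive, negative, positive, negative. -/
def HasFourSignChanges (f : RP1 → ℝ) : Prop :=
  ∃ x₁ x₂ x₃ x₄ : ℝ, x₁ < x₂ ∧ x₂ < x₃ ∧ x₃ < x₄ ∧ x₄ < x₁ + Real.pi ∧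
    0 < f (angle x₁) ∧ f (angle x₂) < 0 ∧ 0 < f (angle x₃) ∧ f (angle x₄) < 0

/-- A bijection of the projective line is an orientation preserving diffeomorphism if, in the
angular parameter, it lifts to a smooth map `ℝ → ℝ` with everywhere positive derivative.
(The inverse then lifts to the inverse function, which is smooth as well.) -/
def IsOrientationPreservingDiffeo (φ : RP1 ≃ RP1) : Prop :=
  ∃ Φ : ℝ → ℝ, ContDiff ℝ ∞ Φ ∧ (∀ x, 0 < deriv Φ x) ∧ ∀ x, φ (angle x) = angle (Φ x)

/-- The affine coordinate on the projective line centred at `p`: if `p = [v]` and `q = [w]`, it is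
`det (v, w) / ⟨v, w⟩`, that is, `tan (y - x)` for `p = angle x`, `q = angle y`. Its point at
infinity is the line orthogonal to `p` (where the value is junk). -/
def affineCoord (p q : RP1) : ℝ :=
  (p.rep 0 * q.rep 1 - p.rep 1 * q.rep 0) / (p.rep 0 * q.rep 0 + p.rep 1 * q.rep 1)

theorem affinePoint_ne_zero (v : Fin 2 → ℝ) (hv : v ≠ 0) (t : ℝ) :
    (![v 0 - t * v 1, v 1 + t * v 0] : Fin 2 → ℝ) ≠ 0 := by
  intro h
  have h0 : v 0 - t * v 1 = 0 := congrFun h 0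
  have h1 : v 1 + t * v 0 = 0 := congrFun h 1
  have hs : v 0 ^ 2 + v 1 ^ 2 = 0 := by linear_combination v 0 * h0 + v 1 * h1
  apply hv
  ext i
  fin_cases i
  · simpa using (show v 0 = 0 by nlinarith [sq_nonneg (v 0), sq_nonneg (v 1)])
  · simpa using (show v 1 = 0 by nlinarith [sq_nonneg (v 0), sq_nonneg (v 1)])

/-- The point whose affine coordinate centred at `p` is `t`. -/
def affinePoint (p : RP1) (t : ℝ) : RP1 :=
  Projectivization.mk ℝ ![p.rep 0 - t * p.rep 1, p.rep 1 + t * p.rep 0]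
    (affinePoint_ne_zero p.rep p.rep_nonzero t)

/-- The expression `h'''/h' - (3/2) (h''/h')²` for a real function of a real variable. -/
def schwarzianReal (h : ℝ → ℝ) (t : ℝ) : ℝ :=
  iteratedDeriv 3 h t / deriv h t - 3 / 2 * (iteratedDeriv 2 h t / deriv h t) ^ 2

/-- The Schwarzian derivative of a self-map `g` of the projective line, as a function on the
projective line: the coefficient of the quadratic differential
`(h'''/h' - (3/2) (h''/h')²) dt²` with respect to `dx²`, where `x` is the angular parameter and
`h` is `g` written in affine coordinates. At `p` the affine coordinate `t = tan (x - x₀)` centred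
at `p = angle x₀` is used in the source, for which `dt = dx` at `p`, and the one centred at `g p`
in the target. (The quadratic differential does not depend on the affine coordinates.) -/
def schwarzian (g : RP1 → RP1) (p : RP1) : ℝ :=
  schwarzianReal (fun t : ℝ => affineCoord (g p) (g (affinePoint p t))) 0

/-- The affine coordinate centred at `angle x` is `tan (y - x)` in the angular parameter `y`. -/
theorem affineCoord_angle (x y : ℝ) : affineCoord (angle x) (angle y) = Real.tan (y - x) := by
  obtain ⟨a, ha⟩ := Projectivization.exists_smul_eq_mk_rep ℝ _ (angle_ne_zero x)
  obtain ⟨b, hb⟩ := Projectivization.exists_smul_eq_mk_rep ℝ _ (angle_ne_zero y)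
  have a0 : (a : ℝ) ≠ 0 := a.ne_zero
  have b0 : (b : ℝ) ≠ 0 := b.ne_zero
  unfold affineCoord angle
  rw [← ha, ← hb, Real.tan_eq_sin_div_cos, Real.sin_sub, Real.cos_sub]
  simp only [Units.smul_def, Pi.smul_apply, smul_eq_mul, Matrix.cons_val_zero, Matrix.cons_val_one]
  rw [← mul_div_mul_left (Real.sin y * Real.cos x - Real.cos y * Real.sin x) _ (mul_ne_zero a0 b0)]
  congr 1 <;> ring

/-- The point with affine coordinate `t` centred at `angle x` is `angle (x + arctan t)`. -/
theorem affinePoint_angle (x t : ℝ) :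
    affinePoint (angle x) t = angle (x + Real.arctan t) := by
  obtain ⟨a, ha⟩ := Projectivization.exists_smul_eq_mk_rep ℝ _ (angle_ne_zero x)
  have a0 : (a : ℝ) ≠ 0 := a.ne_zero
  have hc : Real.cos (Real.arctan t) ≠ 0 := (Real.cos_arctan_pos t).ne'
  have hs : Real.sin (Real.arctan t) = t * Real.cos (Real.arctan t) := by
    conv_rhs => enter [1]; rw [← Real.tan_arctan t]
    rw [Real.tan_mul_cos hc]
  unfold affinePoint
  conv_rhs => unfold angle
  rw [Projectivization.mk_eq_mk_iff']
  refine ⟨a / Real.cos (Real.arctan t), ?_⟩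
  unfold angle
  rw [← ha, Real.cos_add, Real.sin_add, hs]
  ext i
  fin_cases i
  · simp [Units.smul_def]
    field_simp
  · simp [Units.smul_def]
    field_simp

end

end ConverseGhys

namespace ConverseGhys

noncomputable section

/-! If `G` is a lift of `g` to the angular parameter, then S(g) = S(G) + 2 G'² - 2, where S(G) is
the usual Schwarzian of `G` (`schwarzian_angle`). Consequently, if z is a complex solution of Hill's
equation z'' + (1 + q/2) z = 0 whose real and imaginary parts have Wronskian 1, the argument of z is
such a `G` with S(g) = q. It descends to a diffeomorphism of the projective line when z is
antiperiodic and turns by exactly π over a period (`exists_diffeo_of_hill`). The problem is thus to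
choose φ so that Hill's equation with potential q = f ∘ φ has this trivial monodromy.

Write z = α e^{ix} + β e^{-ix}. The vector (α, β), started at (1, 0), must return to (1, 0) at π.
Since |α|² - |β|² is conserved and α stays near 1, the three real equations Im α = 0 and β = 0
suffice. To first order in q they say that ∫ q and ∫ q e^{2ix} vanish over a period.

The inverse ψ of φ stretches small neighbourhoods of four zeros of f until they fill almost the
whole circle, and compresses the rest. The potential is then negligible in mean except for four
short bumps of alternating sign and mass about ε, near the positions 0, π/4, π/2, 3π/4. With equal
weights these bumps cancel in both integrals, because ∑ (-1)^k = ∑ (-1)^k I^k = 0. Varying the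
weights moves the three real quantities freely at order ε (`sum_sign_tilt`, `sum_sign_tilt_I`).

Everything else is O(ε²), and is Lipschitz in the weights with constant O(ε²)
(`norm_fourierError_sub_le`, `norm_volterra_sub_le`). For small ε the contraction principle
therefore gives weights that solve the equations exactly (`exists_parameter`). -/

/-! ### Lifts to the angular parameter. -/

theorem angle_eq_iff {x y : ℝ} : angle x = angle y ↔ ∃ k : ℤ, y = x + k * Real.pi := by
  unfold angle
  rw [Projectivization.mk_eq_mk_iff']
  constructor
  · rintro ⟨a, ha⟩
    have h0 : a * Real.cos y = Real.cos x := by simpa using congrFun ha 0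
    have h1 : a * Real.sin y = Real.sin x := by simpa using congrFun ha 1
    have : Real.sin (y - x) = 0 := by
      rw [Real.sin_sub, ← h0, ← h1]; ring
    obtain ⟨k, hk⟩ := Real.sin_eq_zero_iff.1 this
    exact ⟨k, by linarith⟩
  · rintro ⟨k, rfl⟩
    refine ⟨(-1) ^ k, ?_⟩
    have hk : ((-1 : ℝ) ^ k) * (-1) ^ k = 1 := by
      rw [← mul_zpow]; simp
    ext i
    fin_cases i
    · simp [Real.cos_add_int_mul_pi, ← mul_assoc, hk]
    · simp [Real.sin_add_int_mul_pi, ← mul_assoc, hk]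

theorem angle_add_pi (x : ℝ) : angle (x + Real.pi) = angle x :=
  (angle_eq_iff.2 ⟨1, by simp⟩).symm

theorem angle_surjective : Function.Surjective angle := by
  intro p
  induction p using Projectivization.ind with
  | h v hv =>
    let z : ℂ := ⟨v 0, v 1⟩
    refine ⟨z.arg, ?_⟩
    unfold angle
    rw [Projectivization.mk_eq_mk_iff']
    have hz : z ≠ 0 := by
      intro h
      apply hv
      ext i
      fin_cases i
      · exact congrArg Complex.re h
      · exact congrArg Complex.im h
    have hn : ‖z‖ ≠ 0 := norm_ne_zero_iff.2 hz
    refine ⟨‖z‖⁻¹, ?_⟩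
    ext i
    fin_cases i
    · simp [Complex.cos_arg hz, z, div_eq_inv_mul]
    · simp [Complex.sin_arg, z, div_eq_inv_mul]

theorem add_int_mul_pi_of_add_pi {Φ : ℝ → ℝ} (h : ∀ x, Φ (x + Real.pi) = Φ x + Real.pi)
    (k : ℤ) (x : ℝ) : Φ (x + k * Real.pi) = Φ x + k * Real.pi := by
  have hp : Function.Periodic (fun y => Φ y - y) Real.pi := by
    intro y; simp only [h]; ring
  have := hp.int_mul k x
  linarith

theorem bijective_of_deriv_pos {Φ : ℝ → ℝ} (hΦ : ContDiff ℝ ∞ Φ) (hpos : ∀ x, 0 < deriv Φ x)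
    (h : ∀ x, Φ (x + Real.pi) = Φ x + Real.pi) : Function.Bijective Φ := by
  have hmono : StrictMono Φ := strictMono_of_deriv_pos hpos
  refine ⟨hmono.injective, ?_⟩
  intro y
  have hsurj : ∃ a b : ℝ, Φ a ≤ y ∧ y ≤ Φ b := by
    obtain ⟨n, hn⟩ := exists_int_gt ((y - Φ 0) / Real.pi)
    obtain ⟨m, hm⟩ := exists_int_lt ((y - Φ 0) / Real.pi)
    refine ⟨m * Real.pi, n * Real.pi, ?_, ?_⟩
    · have := add_int_mul_pi_of_add_pi h m 0
      rw [lt_div_iff₀ Real.pi_pos] at hm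
      rw [zero_add] at this
      linarith
    · have := add_int_mul_pi_of_add_pi h n 0
      rw [div_lt_iff₀ Real.pi_pos] at hn
      rw [zero_add] at this
      linarith
  obtain ⟨a, b, ha, hb⟩ := hsurj
  exact mem_range_of_exists_le_of_exists_ge hΦ.continuous ⟨a, ha⟩ ⟨b, hb⟩

/-- An increasing smooth map of the line commuting with the translation by `π` is the lift of an
orientation preserving diffeomorphism of the projective line. -/
theorem exists_equiv_of_lift {Φ : ℝ → ℝ} (hΦ : ContDiff ℝ ∞ Φ) (hpos : ∀ x, 0 < deriv Φ x)
    (h : ∀ x, Φ (x + Real.pi) = Φ x + Real.pi) :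
    ∃ e : RP1 ≃ RP1, IsOrientationPreservingDiffeo e ∧ ∀ x, e (angle x) = angle (Φ x) := by
  have hb := bijective_of_deriv_pos hΦ hpos h
  let e : RP1 → RP1 := fun p => angle (Φ (Function.surjInv angle_surjective p))
  have he : ∀ x, e (angle x) = angle (Φ x) := by
    intro x
    have h1 : angle (Function.surjInv angle_surjective (angle x)) = angle x :=
      Function.surjInv_eq angle_surjective _
    obtain ⟨k, hk⟩ := angle_eq_iff.1 h1
    refine angle_eq_iff.2 ⟨k, ?_⟩
    conv_lhs => rw [hk]
    rw [add_int_mul_pi_of_add_pi h]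
  have hbij : Function.Bijective e := by
    constructor
    · intro p q hpq
      obtain ⟨x, rfl⟩ := angle_surjective p
      obtain ⟨y, rfl⟩ := angle_surjective q
      rw [he, he] at hpq
      obtain ⟨k, hk⟩ := angle_eq_iff.1 hpq
      rw [← add_int_mul_pi_of_add_pi h] at hk
      exact angle_eq_iff.2 ⟨k, hb.1 hk⟩
    · intro p
      obtain ⟨x, rfl⟩ := angle_surjective p
      obtain ⟨y, rfl⟩ := hb.2 x
      exact ⟨angle y, he y⟩
  exact ⟨Equiv.ofBijective e hbij, ⟨Φ, hΦ, hpos, he⟩, he⟩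

/-! ### The Schwarzian derivative in the angular parameter. -/

/-- The Schwarzian derivative in terms of the lift to the angular parameter. -/
theorem schwarzian_angle {g : RP1 → RP1} {G p p₁ p₂ : ℝ → ℝ}
    (hg : ∀ x, g (angle x) = angle (G x)) (hG : ∀ x, HasDerivAt G (p x) x)
    (hp : ∀ x, HasDerivAt p (p₁ x) x) (hp₁ : ∀ x, HasDerivAt p₁ (p₂ x) x) (x : ℝ)
    (hx : p x ≠ 0) :
    schwarzian g (angle x) =
      p₂ x / p x - 3 / 2 * (p₁ x / p x) ^ 2 + 2 * p x ^ 2 - 2 := by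
  set θ : ℝ → ℝ := fun t => x + Real.arctan t with hθ
  set h : ℝ → ℝ := fun t => Real.tan (G (θ t) - G x) with hh
  have hfun : (fun t : ℝ => affineCoord (g (angle x)) (g (affinePoint (angle x) t))) = h := by
    funext t
    rw [affinePoint_angle, hg, hg, affineCoord_angle]
  have hθd : ∀ t, HasDerivAt θ (1 / (1 + t ^ 2)) t := fun t =>
    (Real.hasDerivAt_arctan t).const_add x
  have hθ0 : θ 0 = x := by simp [hθ]
  have hGθ : ∀ t, HasDerivAt (fun t => G (θ t) - G x) (p (θ t) * (1 / (1 + t ^ 2))) t :=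
    fun t => ((hG (θ t)).comp t (hθd t)).sub_const _
  have hcont : Continuous fun t => Real.cos (G (θ t) - G x) :=
    Real.continuous_cos.comp
      (continuous_iff_continuousAt.2 fun t => (hGθ t).continuousAt)
  -- The tangent is differentiable only where the cosine is nonzero, so the formulas `h₁`, `h₂` for
  -- the derivatives hold only near 0. Equality of germs is enough for the iterated derivatives at
  -- 0.
  have hev : ∀ᶠ t in nhds (0 : ℝ), Real.cos (G (θ t) - G x) ≠ 0 := by
    apply hcont.continuousAt.eventually_ne
    simp [hθ0]
  have hpos : ∀ t : ℝ, 1 + t ^ 2 ≠ 0 := fun t => by positivity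
  set h₁ : ℝ → ℝ := fun t => (1 + h t ^ 2) * (p (θ t) * (1 / (1 + t ^ 2))) with hh₁
  have d1 : ∀ t, Real.cos (G (θ t) - G x) ≠ 0 → HasDerivAt h (h₁ t) t := by
    intro t ht
    have := (Real.hasDerivAt_tan ht).comp t (hGθ t)
    refine this.congr_deriv ?_
    simp only [hh₁, hh]
    rw [Real.tan_eq_sin_div_cos]
    have := Real.sin_sq_add_cos_sq (G (θ t) - G x)
    have e : 1 + (Real.sin (G (θ t) - G x) / Real.cos (G (θ t) - G x)) ^ 2 =
        1 / Real.cos (G (θ t) - G x) ^ 2 := by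
      field_simp
      linarith
    rw [e]
  have dinv : ∀ t : ℝ, HasDerivAt (fun t : ℝ => 1 / (1 + t ^ 2)) (-(2 * t) / (1 + t ^ 2) ^ 2) t := by
    intro t
    have h2 : HasDerivAt (fun t : ℝ => 1 + t ^ 2) (2 * t) t := by
      simpa using (hasDerivAt_pow 2 t).const_add 1
    simpa only [one_div] using h2.fun_inv (hpos t)
  have dk : ∀ t, HasDerivAt (fun t => p (θ t) * (1 / (1 + t ^ 2)))
      (p₁ (θ t) * (1 / (1 + t ^ 2)) * (1 / (1 + t ^ 2)) +
        p (θ t) * (-(2 * t) / (1 + t ^ 2) ^ 2)) t :=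
    fun t => ((hp (θ t)).comp t (hθd t)).mul (dinv t)
  set h₂ : ℝ → ℝ := fun t => (2 * h t * h₁ t) * (p (θ t) * (1 / (1 + t ^ 2))) + (1 + h t ^ 2) *
      (p₁ (θ t) * (1 / (1 + t ^ 2)) * (1 / (1 + t ^ 2)) +
        p (θ t) * (-(2 * t) / (1 + t ^ 2) ^ 2)) with hh₂
  have d2 : ∀ t, Real.cos (G (θ t) - G x) ≠ 0 → HasDerivAt h₁ (h₂ t) t := by
    intro t ht
    have := (((d1 t ht).pow 2).const_add 1).mul (dk t)
    exact this.congr_deriv (by simp [hh₂])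
  have h0 : h 0 = 0 := by simp [hh, hθ0]
  have h10 : h₁ 0 = p x := by simp [hh₁, h0, hθ0]
  have h20 : h₂ 0 = p₁ x := by simp [hh₂, h0, hθ0]
  have c0 : Real.cos (G (θ 0) - G x) ≠ 0 := by simp [hθ0]
  -- The term 2p³ comes from the tangent in the target, the term -2p from the arctangent in the
  -- source.
  have d3 : HasDerivAt h₂ (2 * p x ^ 3 + p₂ x - 2 * p x) 0 := by
    have e1 := d1 0 c0
    have e2 := d2 0 c0
    have dinv2 : HasDerivAt (fun t : ℝ => -(2 * t) / (1 + t ^ 2) ^ 2) (-2) 0 := by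
      have n1 : HasDerivAt (fun t : ℝ => -(2 * t)) (-2) 0 := by
        simpa using ((hasDerivAt_id (0 : ℝ)).const_mul 2).fun_neg
      have n2 : HasDerivAt (fun t : ℝ => (1 + t ^ 2) ^ 2) 0 0 := by
        have := (((hasDerivAt_pow 2 (0 : ℝ)).const_add 1).fun_pow 2)
        simpa using this
      simpa using n1.fun_div n2 (by simp)
    have e3 := (((e1.const_mul 2).mul e2).mul (dk 0)).add
      (((e1.pow 2).const_add 1).mul
        (((((hp₁ (θ 0)).comp 0 (hθd 0)).mul (dinv 0)).mul (dinv 0)).add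
          (((hp (θ 0)).comp 0 (hθd 0)).mul dinv2)))
    refine (e3.congr_deriv ?_)
    simp [h0, h10, h20, hθ0]
    ring
  have D1 : deriv h =ᶠ[nhds 0] h₁ := hev.mono fun t ht => (d1 t ht).deriv
  have D2 : deriv (deriv h) =ᶠ[nhds 0] h₂ :=
    D1.deriv.trans (hev.mono fun t ht => (d2 t ht).deriv)
  have D3 : deriv (deriv (deriv h)) 0 = 2 * p x ^ 3 + p₂ x - 2 * p x :=
    (D2.deriv_eq).trans d3.deriv
  unfold schwarzian
  rw [hfun]
  unfold schwarzianReal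
  simp only [iteratedDeriv_succ, iteratedDeriv_zero]
  rw [D3, D2.eq_of_nhds, D1.eq_of_nhds, h10, h20]
  field_simp
  ring

/-! ### Linear differential equations as Volterra integral equations. -/

section Volterra

variable {E : Type*} [NormedAddCommGroup E] [NormedSpace ℝ E] {a b : ℝ}

/-- The Volterra operator `V ↦ ∫ A V` of a linear differential equation `V' = A V` on `[a, b]`. -/
def volterra [CompleteSpace E] (hab : a ≤ b) (A : C(ℝ, E →L[ℝ] E)) (V : C(Set.Icc a b, E)) :
    C(Set.Icc a b, E) where
  toFun s := ∫ t in a..s, A t (V (Set.projIcc a b hab t))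
  continuous_toFun := by
    have hc : Continuous fun t => A t (V (Set.projIcc a b hab t)) :=
      A.continuous.clm_apply (V.continuous.comp continuous_projIcc)
    exact (intervalIntegral.continuous_primitive
      (fun _ _ => hc.intervalIntegrable _ _) a).comp continuous_subtype_val

variable (hab : a ≤ b)

theorem continuous_volterra_integrand (A : C(ℝ, E →L[ℝ] E)) (V : C(Set.Icc a b, E)) :
    Continuous fun t => A t (V (Set.projIcc a b hab t)) :=
  A.continuous.clm_apply (V.continuous.comp continuous_projIcc)

variable [CompleteSpace E]

theorem volterra_sub_left (A B : C(ℝ, E →L[ℝ] E)) (V : C(Set.Icc a b, E)) :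
    volterra hab (A - B) V = volterra hab A V - volterra hab B V := by
  ext s
  simp only [volterra, ContinuousMap.coe_mk, ContinuousMap.sub_apply,
    sub_apply]
  exact intervalIntegral.integral_sub
    ((continuous_volterra_integrand hab A V).intervalIntegrable _ _)
    ((continuous_volterra_integrand hab B V).intervalIntegrable _ _)

theorem volterra_sub_right (A : C(ℝ, E →L[ℝ] E)) (V W : C(Set.Icc a b, E)) :
    volterra hab A (V - W) = volterra hab A V - volterra hab A W := by
  ext s
  simp only [volterra, ContinuousMap.coe_mk, ContinuousMap.sub_apply, map_sub]
  exact intervalIntegral.integral_sub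
    ((continuous_volterra_integrand hab A V).intervalIntegrable _ _)
    ((continuous_volterra_integrand hab A W).intervalIntegrable _ _)

/-- Only the integral of `‖A‖` enters, not its supremum. This matters because the coefficients used
later have tall narrow peaks but a small integral. -/
theorem norm_volterra_le {A : C(ℝ, E →L[ℝ] E)} {m : ℝ → ℝ} (hm : Continuous m) {δ : ℝ}
    (hA : ∀ t ∈ Set.Icc a b, ‖A t‖ ≤ m t) (hδ : ∫ t in a..b, m t ≤ δ)
    (V : C(Set.Icc a b, E)) : ‖volterra hab A V‖ ≤ δ * ‖V‖ := by
  have hm0 : ∀ t ∈ Set.Icc a b, 0 ≤ m t := fun t ht => (norm_nonneg _).trans (hA t ht)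
  have hint : 0 ≤ ∫ t in a..b, m t := intervalIntegral.integral_nonneg hab hm0
  rw [ContinuousMap.norm_le _ (mul_nonneg (hint.trans hδ) (norm_nonneg _))]
  intro s
  have h1 : ‖∫ t in a..s, A t (V (Set.projIcc a b hab t))‖ ≤ ∫ t in a..s, m t * ‖V‖ := by
    apply intervalIntegral.norm_integral_le_of_norm_le s.2.1
    · refine Filter.Eventually.of_forall fun t ht => ?_
      have ht' : t ∈ Set.Icc a b := ⟨ht.1.le, ht.2.trans s.2.2⟩
      exact ((A t).le_opNorm _).trans (mul_le_mul (hA t ht') (V.norm_coe_le_norm _)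
        (norm_nonneg _) (hm0 t ht'))
    · exact (hm.mul continuous_const).intervalIntegrable _ _
  refine h1.trans ?_
  rw [intervalIntegral.integral_mul_const]
  refine mul_le_mul_of_nonneg_right (le_trans ?_ hδ) (norm_nonneg _)
  apply intervalIntegral.integral_mono_interval le_rfl s.2.1 s.2.2
  · refine (MeasureTheory.ae_restrict_mem measurableSet_Ioc).mono fun t ht => ?_
    exact hm0 t ⟨ht.1.le, ht.2⟩
  · exact hm.intervalIntegrable _ _

/-- Since the integral of `‖A‖` over the whole interval is below 1, the Picard map is itself a
contraction for the sup norm. -/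
theorem exists_eq_const_add_volterra {A : C(ℝ, E →L[ℝ] E)} {m : ℝ → ℝ} (hm : Continuous m)
    {δ : ℝ} (hA : ∀ t ∈ Set.Icc a b, ‖A t‖ ≤ m t) (hδ : ∫ t in a..b, m t ≤ δ) (hδ1 : δ < 1)
    (v : E) : ∃ V : C(Set.Icc a b, E), V = ContinuousMap.const _ v + volterra hab A V := by
  have hδ0 : 0 ≤ δ := (intervalIntegral.integral_nonneg hab
    fun t ht => (norm_nonneg _).trans (hA t ht)).trans hδ
  have hc : ContractingWith ⟨δ, hδ0⟩
      (fun V : C(Set.Icc a b, E) => ContinuousMap.const _ v + volterra hab A V) := by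
    refine ⟨hδ1, LipschitzWith.of_dist_le_mul fun V W => ?_⟩
    rw [dist_add_left, dist_eq_norm, dist_eq_norm, ← volterra_sub_right]
    exact norm_volterra_le hab hm hA hδ _
  exact ⟨hc.fixedPoint, hc.fixedPoint_isFixedPt.symm⟩

theorem norm_le_of_eq_const_add_volterra {A : C(ℝ, E →L[ℝ] E)} {m : ℝ → ℝ} (hm : Continuous m)
    {δ : ℝ} (hA : ∀ t ∈ Set.Icc a b, ‖A t‖ ≤ m t) (hδ : ∫ t in a..b, m t ≤ δ) (hδ1 : δ ≤ 1 / 2)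
    {v : E} (hv : ‖v‖ ≤ 1) {V : C(Set.Icc a b, E)}
    (hV : V = ContinuousMap.const _ v + volterra hab A V) :
    ‖V‖ ≤ 2 ∧ ‖V - ContinuousMap.const _ v‖ ≤ 2 * δ := by
  have hδ0 : 0 ≤ δ := (intervalIntegral.integral_nonneg hab
    fun t ht => (norm_nonneg _).trans (hA t ht)).trans hδ
  have h1 := norm_volterra_le hab hm hA hδ V
  have h2 : ‖(ContinuousMap.const (Set.Icc a b) v)‖ ≤ 1 :=
    (ContinuousMap.norm_le _ zero_le_one).2 fun _ => hv
  have h3 : V - ContinuousMap.const _ v = volterra hab A V := sub_eq_iff_eq_add'.2 hV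
  have h4 : ‖V‖ ≤ 1 + δ * ‖V‖ := by
    calc ‖V‖ = ‖ContinuousMap.const _ v + volterra hab A V‖ := by rw [← hV]
      _ ≤ _ := (norm_add_le _ _).trans (add_le_add h2 h1)
  have h5 : ‖V‖ ≤ 2 := by nlinarith [norm_nonneg V]
  refine ⟨h5, ?_⟩
  rw [h3]
  nlinarith

/-- Dependence on the coefficients of the part of the solution that is of second order. -/
theorem norm_volterra_sub_le {A B : C(ℝ, E →L[ℝ] E)} {m m' : ℝ → ℝ} (hm : Continuous m)
    (hm' : Continuous m') {δ δ' : ℝ} (hA : ∀ t ∈ Set.Icc a b, ‖A t‖ ≤ m t)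
    (hB : ∀ t ∈ Set.Icc a b, ‖B t‖ ≤ m t) (hAB : ∀ t ∈ Set.Icc a b, ‖A t - B t‖ ≤ m' t)
    (hδ : ∫ t in a..b, m t ≤ δ) (hδ' : ∫ t in a..b, m' t ≤ δ') (hδ1 : δ ≤ 1 / 2)
    {v : E} (hv : ‖v‖ ≤ 1) {V W : C(Set.Icc a b, E)}
    (hV : V = ContinuousMap.const _ v + volterra hab A V)
    (hW : W = ContinuousMap.const _ v + volterra hab B W) :
    ‖volterra hab A (V - ContinuousMap.const _ v) - volterra hab B (W - ContinuousMap.const _ v)‖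
      ≤ 6 * δ * δ' := by
  obtain ⟨hV1, hV2⟩ := norm_le_of_eq_const_add_volterra hab hm hA hδ hδ1 hv hV
  obtain ⟨hW1, hW2⟩ := norm_le_of_eq_const_add_volterra hab hm hB hδ hδ1 hv hW
  have hδ0 : 0 ≤ δ := (intervalIntegral.integral_nonneg hab
    fun t ht => (norm_nonneg _).trans (hA t ht)).trans hδ
  have hδ0' : 0 ≤ δ' := (intervalIntegral.integral_nonneg hab
    fun t ht => (norm_nonneg _).trans (hAB t ht)).trans hδ'
  have hAB' : ∀ t ∈ Set.Icc a b, ‖(A - B) t‖ ≤ m' t := hAB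
  -- The difference solves the equation of `B` with source `(A - B) V`; absorbing the last term
  -- gives `‖V - W‖ ≤ 4 δ'`.
  have h1 : V - W = volterra hab (A - B) V + volterra hab B (V - W) := by
    rw [volterra_sub_left, volterra_sub_right]
    conv_lhs => rw [hV, hW]
    abel
  have h2 := norm_volterra_le hab hm' hAB' hδ' V
  have h3 := norm_volterra_le hab hm hB hδ (V - W)
  have h4 : ‖V - W‖ ≤ δ' * ‖V‖ + δ * ‖V - W‖ := by
    calc ‖V - W‖ = ‖volterra hab (A - B) V + volterra hab B (V - W)‖ := by rw [← h1]
      _ ≤ _ := (norm_add_le _ _).trans (add_le_add h2 h3)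
  have h5 : ‖V - W‖ ≤ 4 * δ' := by nlinarith [norm_nonneg (V - W)]
  -- The two terms are bounded by δ' · 2δ and δ · 4δ', hence the constant 6.
  have h6 : volterra hab A (V - ContinuousMap.const _ v) -
      volterra hab B (W - ContinuousMap.const _ v) =
      volterra hab (A - B) (V - ContinuousMap.const _ v) + volterra hab B (V - W) := by
    rw [volterra_sub_left]
    simp only [volterra_sub_right]
    abel
  rw [h6]
  have h7 := norm_volterra_le hab hm' hAB' hδ' (V - ContinuousMap.const _ v)
  refine (norm_add_le _ _).trans ((add_le_add h7 h3).trans ?_)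
  nlinarith

end Volterra

/-! ### Hill's equation in the rotating frame. -/

theorem norm_cexp_sub_cexp_le (x y : ℝ) :
    ‖Complex.exp (2 * x * Complex.I) - Complex.exp (2 * y * Complex.I)‖ ≤ 2 * |x - y| := by
  have h : Complex.exp (2 * x * Complex.I) - Complex.exp (2 * y * Complex.I) =
      Complex.exp ((2 * y : ℝ) * Complex.I) *
        (Complex.exp (Complex.I * (2 * (x - y) : ℝ)) - 1) := by
    rw [mul_sub, ← Complex.exp_add]
    push_cast
    ring_nf
  rw [h, norm_mul, Complex.norm_exp_ofReal_mul_I, one_mul]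
  refine (Real.norm_exp_I_mul_ofReal_sub_one_le).trans ?_
  rw [Real.norm_eq_abs, abs_mul]
  simp

theorem norm_cexp_two_mul (x : ℝ) : ‖Complex.exp (2 * x * Complex.I)‖ = 1 := by
  have := Complex.norm_exp_ofReal_mul_I (2 * x)
  push_cast at this
  exact this

/-- The matrix of Hill's equation `z'' + (1 + q / 2) z = 0` in the frame `e^{ix}, e^{-ix}`: writing
`z = α e^{ix} + β e^{-ix}` and `z' = i (α e^{ix} - β e^{-ix})`, one has `V' = q • hillMatrix x V`
for `V = (α, β)`. -/
def hillMatrix (x : ℝ) : (ℂ × ℂ) →L[ℝ] (ℂ × ℂ) :=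
  let L : ℂ → ((ℂ × ℂ) →L[ℂ] (ℂ × ℂ)) := fun e =>
    ((Complex.I / 4) • (ContinuousLinearMap.fst ℂ ℂ ℂ +
      (starRingEnd ℂ e) • ContinuousLinearMap.snd ℂ ℂ ℂ)).prod
    ((-(Complex.I / 4)) • (e • ContinuousLinearMap.fst ℂ ℂ ℂ + ContinuousLinearMap.snd ℂ ℂ ℂ))
  (L (Complex.exp (2 * x * Complex.I))).restrictScalars ℝ

theorem hillMatrix_apply (x : ℝ) (v : ℂ × ℂ) :
    hillMatrix x v =
      (Complex.I / 4 * (v.1 + (starRingEnd ℂ (Complex.exp (2 * x * Complex.I))) * v.2),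
        -(Complex.I / 4) * (Complex.exp (2 * x * Complex.I) * v.1 + v.2)) := by
  simp only [hillMatrix, ContinuousLinearMap.coe_restrictScalars', ContinuousLinearMap.prod_apply,
    smul_apply, add_apply, ContinuousLinearMap.coe_fst', ContinuousLinearMap.coe_snd', smul_eq_mul]

theorem norm_hillMatrix_le (x : ℝ) : ‖hillMatrix x‖ ≤ 1 / 2 := by
  refine ContinuousLinearMap.opNorm_le_bound _ (by norm_num) fun v => ?_
  have h1 := norm_fst_le v
  have h2 := norm_snd_le v
  rw [hillMatrix_apply, Prod.norm_mk]
  refine max_le ?_ ?_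
  · rw [norm_mul]
    have := norm_add_le v.1 ((starRingEnd ℂ (Complex.exp (2 * x * Complex.I))) * v.2)
    rw [norm_mul, RCLike.norm_conj, norm_cexp_two_mul] at this
    simp
    linarith
  · rw [norm_mul]
    have := norm_add_le (Complex.exp (2 * x * Complex.I) * v.1) v.2
    rw [norm_mul, norm_cexp_two_mul] at this
    simp
    linarith

theorem norm_hillMatrix_sub_le (x y : ℝ) :
    ‖hillMatrix x - hillMatrix y‖ ≤ 1 / 2 * |x - y| := by
  refine ContinuousLinearMap.opNorm_le_bound _ (by positivity) fun v => ?_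
  have h1 := norm_fst_le v
  have h2 := norm_snd_le v
  have h3 := norm_cexp_sub_cexp_le x y
  have h0 := abs_nonneg (x - y)
  rw [sub_apply, hillMatrix_apply, hillMatrix_apply, Prod.mk_sub_mk,
    Prod.norm_mk]
  refine max_le ?_ ?_
  · have e : Complex.I / 4 * (v.1 + (starRingEnd ℂ (Complex.exp (2 * x * Complex.I))) * v.2) -
        Complex.I / 4 * (v.1 + (starRingEnd ℂ (Complex.exp (2 * y * Complex.I))) * v.2) =
        Complex.I / 4 * (starRingEnd ℂ (Complex.exp (2 * x * Complex.I) -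
          Complex.exp (2 * y * Complex.I)) * v.2) := by
      rw [map_sub]; ring
    rw [e, norm_mul, norm_mul, RCLike.norm_conj]
    have := mul_le_mul h3 h2 (norm_nonneg _) (by positivity)
    simp
    linarith
  · have e : -(Complex.I / 4) * (Complex.exp (2 * x * Complex.I) * v.1 + v.2) -
        -(Complex.I / 4) * (Complex.exp (2 * y * Complex.I) * v.1 + v.2) =
        -(Complex.I / 4) * ((Complex.exp (2 * x * Complex.I) -
          Complex.exp (2 * y * Complex.I)) * v.1) := by ring
    rw [e, norm_mul, norm_mul]
    have := mul_le_mul h3 h1 (norm_nonneg _) (by positivity)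
    simp
    linarith

theorem continuous_hillMatrix : Continuous hillMatrix := by
  refine LipschitzWith.continuous (K := 1 / 2) (LipschitzWith.of_dist_le_mul fun x y => ?_)
  rw [dist_eq_norm, Real.dist_eq]
  simpa using norm_hillMatrix_sub_le x y

/-! ### Bumps at alternating points and at the zeros between them. -/

/-- Under translation by π both sines change sign, so their product is π-periodic. For 0 ≤ a < b ≤ π
it is positive on (a, b) and nonpositive on the rest of [0, π], so this function is a smooth
periodic bump on (a, b). -/
theorem contDiff_expNegInvGlue_sin (a b : ℝ) :
    ContDiff ℝ ∞ fun s => expNegInvGlue (Real.sin (s - a) * Real.sin (b - s)) :=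
  expNegInvGlue.contDiff.comp (by fun_prop)

/-- A smooth nonnegative `π`-periodic function supported in a given subinterval of `[0, π]`,
normalized with respect to a given weight. -/
theorem exists_periodic_bump {w : ℝ → ℝ} (hw : Continuous w) {a b : ℝ} (ha : 0 ≤ a) (hab : a < b)
    (hb : b ≤ Real.pi) (hpos : ∀ s ∈ Set.Ioo a b, 0 < w s) :
    ∃ χ : ℝ → ℝ, ContDiff ℝ ∞ χ ∧ Function.Periodic χ Real.pi ∧ (∀ s, 0 ≤ χ s) ∧
      (∀ s ∈ Set.Icc 0 Real.pi, s ∉ Set.Ioo a b → χ s = 0) ∧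
      ∫ s in 0..Real.pi, w s * χ s = 1 := by
  set u : ℝ → ℝ := fun s => expNegInvGlue (Real.sin (s - a) * Real.sin (b - s)) with hu
  have hsm : ContDiff ℝ ∞ u := contDiff_expNegInvGlue_sin a b
  have hper : Function.Periodic u Real.pi := by
    intro s
    have h1 : Real.sin (s + Real.pi - a) = -Real.sin (s - a) := by
      rw [show s + Real.pi - a = s - a + Real.pi by ring, Real.sin_add_pi]
    have h2 : Real.sin (b - (s + Real.pi)) = -Real.sin (b - s) := by
      rw [show b - (s + Real.pi) = b - s - Real.pi by ring, Real.sin_sub_pi]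
    simp only [hu, h1, h2, neg_mul_neg]
  have hsupp : ∀ s ∈ Set.Icc 0 Real.pi, s ∉ Set.Ioo a b → u s = 0 := by
    intro s hs hs'
    apply expNegInvGlue.zero_of_nonpos
    rw [Set.mem_Ioo, not_and_or, not_lt, not_lt] at hs'
    rcases hs' with h | h
    · exact mul_nonpos_of_nonpos_of_nonneg
        (Real.sin_nonpos_of_nonpos_of_neg_pi_le (by linarith) (by linarith [hs.1]))
        (Real.sin_nonneg_of_nonneg_of_le_pi (by linarith) (by linarith [hs.1]))
    · exact mul_nonpos_of_nonneg_of_nonpos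
        (Real.sin_nonneg_of_nonneg_of_le_pi (by linarith) (by linarith [hs.2]))
        (Real.sin_nonpos_of_nonpos_of_neg_pi_le (by linarith) (by linarith [hs.2]))
  have hc : Continuous fun s => w s * u s := hw.mul hsm.continuous
  -- The sign of `w` is known only on (a, b), so the integral is restricted to it before positivity
  -- is proved.
  have hI : ∫ s in 0..Real.pi, w s * u s = ∫ s in a..b, w s * u s := by
    have z1 : ∫ s in 0..a, w s * u s = 0 := by
      rw [intervalIntegral.integral_congr (g := fun _ => 0)]
      · simp
      · intro s hs
        rw [Set.uIcc_of_le ha] at hs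
        simp [hsupp s ⟨hs.1, hs.2.trans (hab.le.trans hb)⟩ fun h => absurd h.1 (not_lt.2 hs.2)]
    have z2 : ∫ s in b..Real.pi, w s * u s = 0 := by
      rw [intervalIntegral.integral_congr (g := fun _ => 0)]
      · simp
      · intro s hs
        rw [Set.uIcc_of_le hb] at hs
        simp [hsupp s ⟨(ha.trans hab.le).trans hs.1, hs.2⟩ fun h => absurd h.2 (not_lt.2 hs.1)]
    rw [← intervalIntegral.integral_add_adjacent_intervals (b := a) (hc.intervalIntegrable _ _)
      (hc.intervalIntegrable _ _), ← intervalIntegral.integral_add_adjacent_intervals (a := a)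
      (b := b) (hc.intervalIntegrable _ _) (hc.intervalIntegrable _ _), z1, z2]
    ring
  have hIpos : 0 < ∫ s in 0..Real.pi, w s * u s := by
    rw [hI]
    apply intervalIntegral.intervalIntegral_pos_of_pos_on (hc.intervalIntegrable _ _) _ hab
    intro s hs
    refine mul_pos (hpos s hs) (expNegInvGlue.pos_of_pos (mul_pos ?_ ?_))
    · exact Real.sin_pos_of_pos_of_lt_pi (by linarith [hs.1]) (by linarith [hs.1, hs.2])
    · exact Real.sin_pos_of_pos_of_lt_pi (by linarith [hs.2]) (by linarith [hs.1, hs.2])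
  set I := ∫ s in 0..Real.pi, w s * u s with hIdef
  refine ⟨fun s => I⁻¹ * u s, contDiff_const.mul hsm, fun s => by simp only [hper s],
    fun s => mul_nonneg (inv_nonneg.2 hIpos.le) (expNegInvGlue.nonneg _),
    fun s hs hs' => by simp [hsupp s hs hs'], ?_⟩
  have : ∀ s, w s * (I⁻¹ * u s) = I⁻¹ * (w s * u s) := fun s => by ring
  simp only [this, intervalIntegral.integral_const_mul]
  exact inv_mul_cancel₀ hIpos.ne'

/-- Bumps `b i` near points at which `F` has the sign `(-1) ^ i`, and a sum `β` of four bumps near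
zeros of `F`, arranged alternately on the circle `ℝ / πℤ`. -/
structure BumpConfig (F : ℝ → ℝ) (ε m : ℝ) where
  b : Fin 4 → ℝ → ℝ
  β : ℝ → ℝ
  contDiff_b : ∀ i, ContDiff ℝ ∞ (b i)
  contDiff_β : ContDiff ℝ ∞ β
  periodic_b : ∀ i, Function.Periodic (b i) Real.pi
  periodic_β : Function.Periodic β Real.pi
  b_nonneg : ∀ i s, 0 ≤ b i s
  β_nonneg : ∀ s, 0 ≤ β s
  mul_b : ∀ i, ∀ s ∈ Set.Icc 0 Real.pi, F s * b i s = (-1) ^ (i : ℕ) * (|F s| * b i s)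
  integral_b : ∀ i, ∫ s in 0..Real.pi, |F s| * b i s = 1
  integral_β : ∫ s in 0..Real.pi, β s = 4
  integral_β_of_ne : ∀ i, ∀ s ∈ Set.Icc 0 Real.pi, b i s ≠ 0 → ∫ t in 0..s, β t = (i : ℕ)
  integral_mul_β_le : ∫ s in 0..Real.pi, |F s| * β s ≤ 4 * ε ^ 2
  mass_le : ∑ i, ∫ s in 0..Real.pi, b i s ≤ m

/-- The intermediate value theorem gives a zero `z i` after each `q i`; the last one uses F π = F 0
> 0. The radius `η` makes the eight intervals disjoint and keeps them inside [0, π]. -/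
theorem exists_alternating_points {F : ℝ → ℝ} (hF : Continuous F)
    (hper : Function.Periodic F Real.pi) {p₂ p₃ p₄ : ℝ} (h2 : 0 < p₂) (h23 : p₂ < p₃)
    (h34 : p₃ < p₄) (h4 : p₄ < Real.pi) (f1 : 0 < F 0) (f2 : F p₂ < 0) (f3 : 0 < F p₃)
    (f4 : F p₄ < 0) :
    ∃ (q z : Fin 4 → ℝ) (η : ℝ), 0 < η ∧ (∀ i j, j < i → z j + η ≤ q i - η) ∧
      (∀ i j, i ≤ j → q i + η ≤ z j - η) ∧ (∀ i, 0 ≤ q i - η) ∧ (∀ i, z i + η ≤ Real.pi) ∧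
      (∀ i, F (z i) = 0) ∧ ∀ i, ∀ s, |s - q i| < η → 0 < (-1) ^ (i : ℕ) * F s := by
  have hev : ∀ᶠ s in nhds (0 : ℝ), 0 < F s := hF.continuousAt.eventually (lt_mem_nhds f1)
  obtain ⟨r, hr, hrF⟩ := Metric.eventually_nhds_iff.1 hev
  -- The first positive point is moved off 0, so that its bump does not cross the end of the period.
  have hp1 : ∃ p₁, 0 < p₁ ∧ p₁ < p₂ ∧ 0 < F p₁ := by
    refine ⟨min (r / 2) (p₂ / 2), by positivity, ?_, hrF ?_⟩
    · exact (min_le_right _ _).trans_lt (by linarith)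
    · rw [Real.dist_eq, sub_zero, abs_of_pos (by positivity)]
      exact (min_le_left _ _).trans_lt (by linarith)
  obtain ⟨p₁, h1, h12, f1'⟩ := hp1
  have fpi : 0 < F Real.pi := by
    have := hper 0
    rw [zero_add] at this
    rwa [this]
  have ivt : ∀ {x y : ℝ}, x < y → F x * F y < 0 → ∃ z, x < z ∧ z < y ∧ F z = 0 := by
    intro x y hxy h
    rcases mul_neg_iff.1 h with ⟨hx, hy⟩ | ⟨hx, hy⟩
    · obtain ⟨z, hz, hz0⟩ := intermediate_value_Ioo' hxy.le hF.continuousOn ⟨hy, hx⟩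
      exact ⟨z, hz.1, hz.2, hz0⟩
    · obtain ⟨z, hz, hz0⟩ := intermediate_value_Ioo hxy.le hF.continuousOn ⟨hx, hy⟩
      exact ⟨z, hz.1, hz.2, hz0⟩
  obtain ⟨z₁, a1, a1', z1⟩ := ivt h12 (mul_neg_of_pos_of_neg f1' f2)
  obtain ⟨z₂, a2, a2', z2⟩ := ivt h23 (mul_neg_of_neg_of_pos f2 f3)
  obtain ⟨z₃, a3, a3', z3⟩ := ivt h34 (mul_neg_of_pos_of_neg f3 f4)
  obtain ⟨z₄, a4, a4', z4⟩ := ivt h4 (mul_neg_of_neg_of_pos f4 fpi)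
  let q : Fin 4 → ℝ := ![p₁, p₂, p₃, p₄]
  let z : Fin 4 → ℝ := ![z₁, z₂, z₃, z₄]
  have key : ∀ᶠ η in nhdsWithin (0 : ℝ) (Set.Ioi 0), 0 < η ∧ (2 * η < p₁ ∧ 2 * η < z₁ - p₁ ∧
      2 * η < p₂ - z₁ ∧ 2 * η < z₂ - p₂ ∧ 2 * η < p₃ - z₂ ∧ 2 * η < z₃ - p₃ ∧ 2 * η < p₄ - z₃ ∧
      2 * η < z₄ - p₄ ∧ 2 * η < Real.pi - z₄) ∧
      ∀ i, ∀ s, |s - q i| < η → 0 < (-1) ^ (i : ℕ) * F s := by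
    have small : ∀ {c : ℝ}, 0 < c → ∀ᶠ η in nhdsWithin (0 : ℝ) (Set.Ioi 0), 2 * η < c := by
      intro c hc
      have : ∀ᶠ η in nhds (0 : ℝ), 2 * η < c := by
        apply (continuous_const.mul continuous_id).continuousAt.eventually (gt_mem_nhds _)
        simpa using hc
      exact this.filter_mono nhdsWithin_le_nhds
    refine (eventually_mem_nhdsWithin).and (((small h1).and ((small (sub_pos.2 a1)).and
      ((small (sub_pos.2 a1')).and ((small (sub_pos.2 a2)).and ((small (sub_pos.2 a2')).and
      ((small (sub_pos.2 a3)).and ((small (sub_pos.2 a3')).and ((small (sub_pos.2 a4)).and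
      (small (sub_pos.2 a4')))))))))).and ?_)
    rw [Filter.eventually_all]
    intro i
    have hi : 0 < (-1) ^ (i : ℕ) * F (q i) := by
      fin_cases i <;> simp [q, pow_succ] <;> assumption
    have : ∀ᶠ s in nhds (q i), 0 < (-1) ^ (i : ℕ) * F s :=
      (continuous_const.mul hF).continuousAt.eventually (lt_mem_nhds hi)
    obtain ⟨r, hr, hrF⟩ := Metric.eventually_nhds_iff.1 this
    filter_upwards [small hr, eventually_mem_nhdsWithin] with η hη hη0 s hs
    apply hrF
    rw [Real.dist_eq]
    have : (0 : ℝ) < η := hη0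
    linarith
  obtain ⟨η, hη, ⟨c1, c2, c3, c4, c5, c6, c7, c8, c9⟩, hs⟩ := key.exists
  refine ⟨q, z, η, hη, ?_, ?_, ?_, ?_, ?_, hs⟩
  · intro i j hij
    fin_cases i <;> fin_cases j <;> simp at hij <;> simp [q, z] <;> linarith
  · intro i j hij
    fin_cases i <;> fin_cases j <;> simp at hij <;> simp [q, z] <;> linarith
  · intro i
    fin_cases i <;> simp [q] <;> linarith
  · intro i
    fin_cases i <;> simp [z] <;> linarith
  · intro i
    fin_cases i <;> simp [z] <;> assumption

/-- The bumps `b i` and their mass bound `m` are fixed before `ε`; only the bumps at the zeros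
shrink with `ε`. Hence `ε` may later be chosen small in terms of `m`. -/
theorem exists_bumpConfig {F : ℝ → ℝ} (hF : Continuous F)
    (hper : Function.Periodic F Real.pi) {p₂ p₃ p₄ : ℝ} (h2 : 0 < p₂) (h23 : p₂ < p₃)
    (h34 : p₃ < p₄) (h4 : p₄ < Real.pi) (f1 : 0 < F 0) (f2 : F p₂ < 0) (f3 : 0 < F p₃)
    (f4 : F p₄ < 0) :
    ∃ m : ℝ, ∀ ε : ℝ, 0 < ε → Nonempty (BumpConfig F ε m) := by
  obtain ⟨q, z, η, hη, hzq, hqz, hq0, hzpi, hFz, hFq⟩ :=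
    exists_alternating_points hF hper h2 h23 h34 h4 f1 f2 f3 f4
  have hb : ∀ i, ∃ χ : ℝ → ℝ, ContDiff ℝ ∞ χ ∧ Function.Periodic χ Real.pi ∧ (∀ s, 0 ≤ χ s) ∧
      (∀ s ∈ Set.Icc 0 Real.pi, s ∉ Set.Ioo (q i - η) (q i + η) → χ s = 0) ∧
      ∫ s in 0..Real.pi, |F s| * χ s = 1 := by
    intro i
    refine exists_periodic_bump hF.abs (hq0 i) (by linarith)
      (by linarith [hqz i i le_rfl, hzpi i]) fun s hs => ?_
    have := hFq i s (abs_lt.2 ⟨by linarith [hs.1], by linarith [hs.2]⟩)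
    rw [abs_pos]
    rintro h
    simp [h] at this
  choose b hb1 hb2 hb3 hb4 hb5 using hb
  refine ⟨∑ i, ∫ s in 0..Real.pi, b i s, fun ε hε => ?_⟩
  have hβ : ∀ j, ∃ χ : ℝ → ℝ, ContDiff ℝ ∞ χ ∧ Function.Periodic χ Real.pi ∧ (∀ s, 0 ≤ χ s) ∧
      (∀ s ∈ Set.Icc 0 Real.pi, s ∉ Set.Ioo (z j - η) (z j + η) → χ s = 0) ∧
      (∫ s in 0..Real.pi, χ s = 1) ∧ ∀ s ∈ Set.Icc 0 Real.pi, |F s| * χ s ≤ ε ^ 2 * χ s := by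
    intro j
    have hev : ∀ᶠ s in nhds (z j), |F s| < ε ^ 2 := by
      apply hF.abs.continuousAt.eventually (gt_mem_nhds _)
      simp only [hFz, abs_zero]
      positivity
    obtain ⟨r, hr, hrF⟩ := Metric.eventually_nhds_iff.1 hev
    have hd1 : min r η ≤ r := min_le_left _ _
    have hd2 : min r η ≤ η := min_le_right _ _
    have hd0 : 0 < min r η := lt_min hr hη
    obtain ⟨χ, c1, c2, c3, c4, c5⟩ := exists_periodic_bump (w := fun _ => 1) continuous_const
      (a := z j - min r η) (b := z j + min r η)
      (by linarith [hqz j j le_rfl, hq0 j]) (by linarith) (by linarith [hzpi j])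
      (fun _ _ => one_pos)
    refine ⟨χ, c1, c2, c3, fun s hs hs' => c4 s hs fun h => hs' ⟨?_, ?_⟩, by simpa using c5, ?_⟩
    · linarith [h.1]
    · linarith [h.2]
    · intro s hs
      by_cases h : s ∈ Set.Ioo (z j - min r η) (z j + min r η)
      · refine mul_le_mul_of_nonneg_right (hrF ?_).le (c3 s)
        rw [Real.dist_eq, abs_lt]
        exact ⟨by linarith [h.1], by linarith [h.2]⟩
      · simp [c4 s hs h]
  choose β hβ1 hβ2 hβ3 hβ4 hβ5 hβ6 using hβ
  have hint : ∀ j (x y : ℝ), IntervalIntegrable (β j) MeasureTheory.volume x y :=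
    fun j x y => (hβ1 j).continuous.intervalIntegrable _ _
  have hbS : ∀ i, ∀ s ∈ Set.Icc 0 Real.pi, b i s ≠ 0 → s ∈ Set.Ioo (q i - η) (q i + η) :=
    fun i s hs h => by_contra fun h' => h (hb4 i s hs h')
  refine ⟨⟨b, fun s => ∑ j, β j s, hb1, ContDiff.sum fun j _ => hβ1 j, hb2, ?_, hb3, ?_, ?_, hb5,
    ?_, ?_, ?_, le_rfl⟩⟩
  · intro s
    simp only [hβ2 _ s]
  · exact fun s => Finset.sum_nonneg fun j _ => hβ3 j s
  · intro i s hs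
    by_cases h : b i s = 0
    · simp [h]
    · have h1 := hbS i s hs h
      have h2 := hFq i s (abs_lt.2 ⟨by linarith [h1.1], by linarith [h1.2]⟩)
      have h3 : |F s| = (-1) ^ (i : ℕ) * F s := by
        rw [← abs_of_pos h2, abs_mul]
        simp
      rw [h3, ← mul_assoc, ← mul_assoc, ← mul_pow]
      simp
  · rw [intervalIntegral.integral_finsetSum fun j _ => hint j _ _]
    simp [hβ5]
  · intro i s hs h
    have hsi := hbS i s hs h
    rw [intervalIntegral.integral_finsetSum fun j _ => hint j _ _]
    -- On the support of `b i` the unit bumps at the zeros `z j` with j < i have been passed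
    -- completely and the others have not begun.
    have hval : ∀ j, ∫ t in 0..s, β j t = if j < i then 1 else 0 := by
      intro j
      split_ifs with hj
      · have h0 : ∫ t in s..Real.pi, β j t = 0 := by
          rw [intervalIntegral.integral_congr (g := fun _ => 0)]
          · simp
          · intro t ht
            rw [Set.uIcc_of_le hs.2] at ht
            refine hβ4 j t ⟨hs.1.trans ht.1, ht.2⟩ fun h => ?_
            linarith [h.2, ht.1, hsi.1, hzq i j hj]
        have := intervalIntegral.integral_add_adjacent_intervals (hint j 0 s) (hint j s Real.pi)
        rw [h0, hβ5, add_zero] at this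
        exact this
      · rw [intervalIntegral.integral_congr (g := fun _ => 0)]
        · simp
        · intro t ht
          rw [Set.uIcc_of_le hs.1] at ht
          refine hβ4 j t ⟨ht.1, ht.2.trans hs.2⟩ fun h => ?_
          linarith [h.1, ht.2, hsi.2, hqz i j (not_lt.1 hj)]
    have hcard : (Finset.univ.filter fun j => j < i) = Finset.Iio i := by ext; simp
    simp only [hval, Finset.sum_boole, hcard, Fin.card_Iio]
  · calc ∫ s in 0..Real.pi, |F s| * ∑ j, β j s ≤ ∫ s in 0..Real.pi, ε ^ 2 * ∑ j, β j s := by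
          apply intervalIntegral.integral_mono_on Real.pi_pos.le
          · exact (hF.abs.mul (continuous_finsetSum _
              fun j _ => (hβ1 j).continuous)).intervalIntegrable _ _
          · exact (continuous_const.mul (continuous_finsetSum _
              fun j _ => (hβ1 j).continuous)).intervalIntegrable _ _
          · intro s hs
            rw [Finset.mul_sum, Finset.mul_sum]
            exact Finset.sum_le_sum fun j _ => hβ6 j s hs
      _ = 4 * ε ^ 2 := by
          rw [intervalIntegral.integral_const_mul,
            intervalIntegral.integral_finsetSum fun j _ => hint j _ _]
          simp [hβ5]
          ring

/-! ### Bounds for integrals and the weights of the four bumps. -/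

theorem norm_integral_le_of_le_on_Icc {E : Type*} [NormedAddCommGroup E] [NormedSpace ℝ E]
    {f : ℝ → E} {h : ℝ → ℝ} {a b : ℝ} (hab : a ≤ b) (hh : Continuous h)
    (hle : ∀ s ∈ Set.Icc a b, ‖f s‖ ≤ h s) :
    ‖∫ s in a..b, f s‖ ≤ ∫ s in a..b, h s :=
  intervalIntegral.norm_integral_le_of_norm_le hab
    (Filter.Eventually.of_forall fun s hs => hle s ⟨hs.1.le, hs.2⟩) (hh.intervalIntegrable _ _)

theorem norm_integral_sub_le_of_le_on_Icc {E : Type*} [NormedAddCommGroup E] [NormedSpace ℝ E]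
    {f g : ℝ → E} {h : ℝ → ℝ} {a b : ℝ} (hab : a ≤ b) (hf : Continuous f) (hg : Continuous g)
    (hh : Continuous h) (hle : ∀ s ∈ Set.Icc a b, ‖f s - g s‖ ≤ h s) :
    ‖(∫ s in a..b, f s) - ∫ s in a..b, g s‖ ≤ ∫ s in a..b, h s := by
  rw [← intervalIntegral.integral_sub (hf.intervalIntegrable _ _) (hg.intervalIntegrable _ _)]
  exact norm_integral_le_of_le_on_Icc hab hh hle

/-- The right inverse of `w ↦ (∑ (-1) ^ i w i, ∑ (-1) ^ i I ^ i w i)`. -/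
def tilt (τ : ℝ × ℂ) : Fin 4 → ℝ :=
  ![τ.2.re / 2 + τ.1 / 4, -τ.2.im / 2 - τ.1 / 4, -τ.2.re / 2 + τ.1 / 4, τ.2.im / 2 - τ.1 / 4]

theorem abs_tilt_le (τ : ℝ × ℂ) (i : Fin 4) : |tilt τ i| ≤ 3 / 4 * ‖τ‖ := by
  have h1 : |τ.1| ≤ ‖τ‖ := norm_fst_le τ
  have h2 : ‖τ.2‖ ≤ ‖τ‖ := norm_snd_le τ
  have h3 := abs_le.1 (Complex.abs_re_le_norm τ.2)
  have h4 := abs_le.1 (Complex.abs_im_le_norm τ.2)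
  have h5 := abs_le.1 h1
  rw [abs_le]
  fin_cases i <;> simp [tilt] <;> constructor <;> linarith

theorem tilt_sub (τ σ : ℝ × ℂ) (i : Fin 4) : tilt (τ - σ) i = tilt τ i - tilt σ i := by
  fin_cases i <;> simp [tilt] <;> ring

/-- This identity and `sum_sign_tilt_I` say that the weights `1 + tilt τ i` realize any prescribed
mean and second Fourier coefficient; the constant weights contribute 0 to both. -/
theorem sum_sign_tilt (τ : ℝ × ℂ) : ∑ i : Fin 4, (-1) ^ (i : ℕ) * (1 + tilt τ i) = τ.1 := by
  simp [Fin.sum_univ_four, tilt]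
  ring

theorem sum_sign_tilt_I (τ : ℝ × ℂ) :
    ∑ i : Fin 4, (((-1) ^ (i : ℕ) * (1 + tilt τ i) : ℝ) : ℂ) * Complex.I ^ (i : ℕ) = τ.2 := by
  apply Complex.ext <;> simp [Fin.sum_univ_four, tilt, pow_succ] <;> ring

/-- The value of e^{2ix} at x = iπ/4, the approximate position of the i-th bump. -/
theorem I_pow_eq_cexp (i : ℕ) :
    Complex.I ^ i = Complex.exp (2 * ((i * (Real.pi / 4) : ℝ) : ℂ) * Complex.I) := by
  rw [show 2 * ((i * (Real.pi / 4) : ℝ) : ℂ) * Complex.I = (i : ℕ) * (Real.pi / 2 * Complex.I) by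
    push_cast; ring, Complex.exp_nat_mul, Complex.exp_pi_div_two_mul_I]

/-! ### The family of reparametrizations and its first-order estimates. -/

namespace BumpConfig

variable {F : ℝ → ℝ} {ε m K : ℝ} (c : BumpConfig F ε m)

/-- The length given to each of the four gaps, fixed by the requirement that `position τ` map π to
π. It is π/4 + O(ε). -/
def gapMass (τ : ℝ × ℂ) : ℝ :=
  (Real.pi * (1 - ε ^ 2) - ε * ∑ i, (1 + tilt τ i) * ∫ s in 0..Real.pi, c.b i s) / 4

/-- The floor ε² keeps the density positive where all the bumps vanish. The other term carries most
of the length, but lies where |F| < ε². -/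
def remainder (τ : ℝ × ℂ) (s : ℝ) : ℝ := ε ^ 2 + c.gapMass τ * c.β s

/-- The density of the reparametrization with parameter `τ`. -/
def density (τ : ℝ × ℂ) (s : ℝ) : ℝ :=
  ε * ∑ i, (1 + tilt τ i) * c.b i s + c.remainder τ s

/-- The reparametrization with parameter `τ`. -/
def position (τ : ℝ × ℂ) (s : ℝ) : ℝ := ∫ t in 0..s, c.density τ t

def phase (τ : ℝ × ℂ) (s : ℝ) : ℂ := Complex.exp (2 * c.position τ s * Complex.I)

theorem continuous_b (i : Fin 4) : Continuous (c.b i) := (c.contDiff_b i).continuous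

theorem continuous_β : Continuous c.β := c.contDiff_β.continuous

theorem continuous_remainder (τ : ℝ × ℂ) : Continuous (c.remainder τ) :=
  continuous_const.add (continuous_const.mul c.continuous_β)

theorem contDiff_density (τ : ℝ × ℂ) : ContDiff ℝ ∞ (c.density τ) :=
  (contDiff_const.mul (ContDiff.sum fun i _ => contDiff_const.mul (c.contDiff_b i))).add
    (contDiff_const.add (contDiff_const.mul c.contDiff_β))

theorem continuous_density (τ : ℝ × ℂ) : Continuous (c.density τ) :=
  (c.contDiff_density τ).continuous

theorem periodic_density (τ : ℝ × ℂ) : Function.Periodic (c.density τ) Real.pi := by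
  intro s
  simp only [density, remainder, c.periodic_b _ s, c.periodic_β s]

theorem hasDerivAt_position (τ : ℝ × ℂ) (s : ℝ) :
    HasDerivAt (c.position τ) (c.density τ s) s :=
  intervalIntegral.integral_hasDerivAt_right ((c.continuous_density τ).intervalIntegrable _ _)
    ((c.continuous_density τ).stronglyMeasurableAtFilter _ _) (c.continuous_density τ).continuousAt

theorem continuous_position (τ : ℝ × ℂ) : Continuous (c.position τ) :=
  continuous_iff_continuousAt.2 fun s => (c.hasDerivAt_position τ s).continuousAt

theorem continuous_phase (τ : ℝ × ℂ) : Continuous (c.phase τ) := by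
  have := c.continuous_position τ
  unfold phase
  fun_prop

theorem norm_phase (τ : ℝ × ℂ) (s : ℝ) : ‖c.phase τ s‖ = 1 := norm_cexp_two_mul _

theorem integral_b_nonneg (i : Fin 4) {s : ℝ} (hs : 0 ≤ s) : 0 ≤ ∫ t in 0..s, c.b i t :=
  intervalIntegral.integral_nonneg hs fun t _ => c.b_nonneg i t

theorem mass_nonneg (c : BumpConfig F ε m) : 0 ≤ m :=
  (Finset.sum_nonneg fun i _ => c.integral_b_nonneg i Real.pi_pos.le).trans c.mass_le

theorem abs_sum_mul_integral_b_le {u : Fin 4 → ℝ} {r s : ℝ} (hr : 0 ≤ r) (hu : ∀ i, |u i| ≤ r)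
    (hs : s ∈ Set.Icc 0 Real.pi) : |∑ i, u i * ∫ t in 0..s, c.b i t| ≤ r * m := by
  calc |∑ i, u i * ∫ t in 0..s, c.b i t| ≤ ∑ i, |u i * ∫ t in 0..s, c.b i t| :=
        Finset.abs_sum_le_sum_abs _ _
    _ ≤ ∑ i, r * ∫ t in 0..Real.pi, c.b i t := by
        refine Finset.sum_le_sum fun i _ => ?_
        rw [abs_mul, abs_of_nonneg (c.integral_b_nonneg i hs.1)]
        refine mul_le_mul (hu i) ?_ (c.integral_b_nonneg i hs.1) hr
        exact intervalIntegral.integral_mono_interval le_rfl hs.1 hs.2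
          (Filter.Eventually.of_forall fun t => c.b_nonneg i t)
          ((c.continuous_b i).intervalIntegrable _ _)
    _ ≤ r * m := by
        rw [← Finset.mul_sum]
        exact mul_le_mul_of_nonneg_left c.mass_le hr

theorem abs_one_add_tilt_le {τ : ℝ × ℂ} (hτ : ‖τ‖ ≤ 1) (i : Fin 4) : |1 + tilt τ i| ≤ 2 := by
  have := abs_le.1 (abs_tilt_le τ i)
  exact abs_le.2 ⟨by linarith, by linarith⟩

/-- The factor 3/4 in `abs_tilt_le` keeps the weights in [1/4, 7/4] on the unit ball of parameters.
-/
theorem one_add_tilt_nonneg {τ : ℝ × ℂ} (hτ : ‖τ‖ ≤ 1) (i : Fin 4) : 0 ≤ 1 + tilt τ i := by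
  have := abs_le.1 (abs_tilt_le τ i)
  linarith

theorem abs_gapMass_sub_le (hε : 0 ≤ ε) (τ σ : ℝ × ℂ) :
    |c.gapMass τ - c.gapMass σ| ≤ ε * m * ‖τ - σ‖ := by
  have h := c.abs_sum_mul_integral_b_le (u := tilt (τ - σ)) (by positivity)
    (fun i => abs_tilt_le (τ - σ) i) (Set.right_mem_Icc.2 Real.pi_pos.le)
  have e : c.gapMass τ - c.gapMass σ =
      -(ε / 4) * ∑ i, tilt (τ - σ) i * ∫ t in 0..Real.pi, c.b i t := by
    simp only [gapMass, tilt_sub, sub_mul, add_mul, Finset.sum_sub_distrib, Finset.sum_add_distrib]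
    ring
  rw [e, abs_mul, abs_neg, abs_of_nonneg (by positivity)]
  have h0 : 0 ≤ ε * m * ‖τ - σ‖ := mul_nonneg (mul_nonneg hε c.mass_nonneg) (norm_nonneg _)
  have := mul_le_mul_of_nonneg_left h (by positivity : 0 ≤ ε / 4)
  linarith

theorem abs_gapMass_sub_pi_div_four_le (hε : 0 ≤ ε) (hε1 : ε ≤ 1) {τ : ℝ × ℂ} (hτ : ‖τ‖ ≤ 1) :
    |c.gapMass τ - Real.pi / 4| ≤ ε * (Real.pi + 2 * m) / 4 := by
  have h := c.abs_sum_mul_integral_b_le zero_le_two (abs_one_add_tilt_le hτ)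
    (Set.right_mem_Icc.2 Real.pi_pos.le)
  have h1 := abs_le.1 h
  have h2 : ε ^ 2 ≤ ε := by nlinarith
  have h3 := mul_le_mul_of_nonneg_left h1.1 hε
  have h4 := mul_le_mul_of_nonneg_left h1.2 hε
  have h5 := mul_le_mul_of_nonneg_left h2 Real.pi_pos.le
  have h6 := mul_nonneg Real.pi_pos.le (sq_nonneg ε)
  have h7 := mul_nonneg Real.pi_pos.le hε
  rw [abs_le]
  unfold gapMass
  constructor <;> linarith

theorem gapMass_nonneg (hε : 0 ≤ ε) (hε1 : ε ≤ 1) (hεm : ε * (Real.pi + 2 * m) ≤ Real.pi)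
    {τ : ℝ × ℂ} (hτ : ‖τ‖ ≤ 1) : 0 ≤ c.gapMass τ := by
  have := abs_le.1 (c.abs_gapMass_sub_pi_div_four_le hε hε1 hτ)
  linarith

theorem gapMass_le_one (hε : 0 ≤ ε) {τ : ℝ × ℂ} (hτ : ‖τ‖ ≤ 1) : c.gapMass τ ≤ 1 := by
  have h : 0 ≤ ∑ i, (1 + tilt τ i) * ∫ s in 0..Real.pi, c.b i s :=
    Finset.sum_nonneg fun i _ =>
      mul_nonneg (one_add_tilt_nonneg hτ i) (c.integral_b_nonneg i Real.pi_pos.le)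
  have h1 := mul_nonneg hε h
  have h2 := mul_nonneg Real.pi_pos.le (sq_nonneg ε)
  unfold gapMass
  linarith [Real.pi_le_four]

theorem density_pos (hε : 0 < ε) (hε1 : ε ≤ 1) (hεm : ε * (Real.pi + 2 * m) ≤ Real.pi)
    {τ : ℝ × ℂ} (hτ : ‖τ‖ ≤ 1) (s : ℝ) : 0 < c.density τ s := by
  have h1 : 0 ≤ ∑ i, (1 + tilt τ i) * c.b i s :=
    Finset.sum_nonneg fun i _ => mul_nonneg (one_add_tilt_nonneg hτ i) (c.b_nonneg i s)
  have h2 := mul_nonneg (c.gapMass_nonneg hε.le hε1 hεm hτ) (c.β_nonneg s)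
  have h3 := mul_nonneg hε.le h1
  unfold density remainder
  positivity

theorem position_eq (τ : ℝ × ℂ) (s : ℝ) : c.position τ s =
    ε * ∑ i, (1 + tilt τ i) * (∫ t in 0..s, c.b i t) +
      (ε ^ 2 * s + c.gapMass τ * ∫ t in 0..s, c.β t) := by
  have ib : ∀ i, IntervalIntegrable (fun t => (1 + tilt τ i) * c.b i t) MeasureTheory.volume 0 s :=
    fun i => (continuous_const.mul (c.continuous_b i)).intervalIntegrable _ _
  have iβ : IntervalIntegrable (fun t => c.gapMass τ * c.β t) MeasureTheory.volume 0 s :=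
    (continuous_const.mul c.continuous_β).intervalIntegrable _ _
  unfold position density remainder
  rw [intervalIntegral.integral_add, intervalIntegral.integral_const_mul,
    intervalIntegral.integral_finsetSum fun i _ => ib i,
    intervalIntegral.integral_add intervalIntegrable_const iβ,
    intervalIntegral.integral_const_mul]
  · simp only [intervalIntegral.integral_const_mul, intervalIntegral.integral_const, sub_zero,
      smul_eq_mul]
    ring
  · exact (continuous_const.mul (continuous_finsetSum _ fun i _ =>
      continuous_const.mul (c.continuous_b i))).intervalIntegrable _ _
  · exact (c.continuous_remainder τ).intervalIntegrable _ _

theorem position_pi (τ : ℝ × ℂ) : c.position τ Real.pi = Real.pi := by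
  rw [position_eq, c.integral_β]
  unfold gapMass
  ring

theorem position_add_pi (τ : ℝ × ℂ) (s : ℝ) :
    c.position τ (s + Real.pi) = c.position τ s + Real.pi := by
  have hi : ∀ a b, IntervalIntegrable (c.density τ) MeasureTheory.volume a b :=
    fun a b => (c.continuous_density τ).intervalIntegrable a b
  have h := c.position_pi τ
  unfold position at h ⊢
  rw [← intervalIntegral.integral_add_adjacent_intervals (hi 0 s) (hi s (s + Real.pi)),
    (c.periodic_density τ).intervalIntegral_add_eq s 0, zero_add, h]

/-- Exactly i gaps, each of length π/4 + O(ε), precede the i-th bump, and the terms of the density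
other than the gaps contribute only O(ε) to the position. -/
theorem abs_position_sub_le_of_ne (hε : 0 ≤ ε) (hε1 : ε ≤ 1) {τ : ℝ × ℂ} (hτ : ‖τ‖ ≤ 1)
    {i : Fin 4} {s : ℝ} (hs : s ∈ Set.Icc 0 Real.pi) (hb : c.b i s ≠ 0) :
    |c.position τ s - (i : ℕ) * (Real.pi / 4)| ≤ ε * (2 * Real.pi + 4 * m) := by
  rw [position_eq, c.integral_β_of_ne i s hs hb]
  have h1 := c.abs_sum_mul_integral_b_le zero_le_two (abs_one_add_tilt_le hτ) hs
  have h2 := c.abs_gapMass_sub_pi_div_four_le hε hε1 hτ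
  have h3 : (((i : ℕ) : ℝ)) ≤ 4 := by exact_mod_cast i.2.le
  have h4 : (0 : ℝ) ≤ ((i : ℕ) : ℝ) := Nat.cast_nonneg _
  have h5 : ε ^ 2 * s ≤ ε * Real.pi :=
    mul_le_mul (by nlinarith) hs.2 hs.1 hε
  have e : ε * ∑ j, (1 + tilt τ j) * (∫ t in 0..s, c.b j t) +
      (ε ^ 2 * s + c.gapMass τ * (i : ℕ)) - (i : ℕ) * (Real.pi / 4) =
      ε * ∑ j, (1 + tilt τ j) * (∫ t in 0..s, c.b j t) +
      (ε ^ 2 * s + (i : ℕ) * (c.gapMass τ - Real.pi / 4)) := by ring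
  rw [e]
  refine (abs_add_le _ _).trans ?_
  refine (add_le_add_right (abs_add_le _ _) _).trans ?_
  rw [abs_mul, abs_mul (((i : ℕ) : ℝ)), abs_of_nonneg hε, abs_of_nonneg h4,
    abs_of_nonneg (mul_nonneg (sq_nonneg ε) hs.1)]
  have h6 := mul_le_mul_of_nonneg_left h1 hε
  have h7 := mul_le_mul h3 h2 (abs_nonneg _) (by norm_num)
  linarith

theorem abs_remainder_sub_le (hε : 0 ≤ ε) (τ σ : ℝ × ℂ) (s : ℝ) :
    |c.remainder τ s - c.remainder σ s| ≤ ‖τ - σ‖ * (ε * m * c.β s) := by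
  have e : c.remainder τ s - c.remainder σ s = (c.gapMass τ - c.gapMass σ) * c.β s := by
    unfold remainder; ring
  rw [e, abs_mul, abs_of_nonneg (c.β_nonneg s)]
  have := mul_le_mul_of_nonneg_right (c.abs_gapMass_sub_le hε τ σ) (c.β_nonneg s)
  linarith

theorem abs_density_sub_le (hε : 0 ≤ ε) (τ σ : ℝ × ℂ) (s : ℝ) :
    |c.density τ s - c.density σ s| ≤ ‖τ - σ‖ * (ε * ∑ i, c.b i s + ε * m * c.β s) := by
  have e : c.density τ s - c.density σ s =
      ε * ∑ i, tilt (τ - σ) i * c.b i s + (c.remainder τ s - c.remainder σ s) := by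
    simp only [density, tilt_sub, sub_mul, add_mul, Finset.sum_sub_distrib,
      Finset.sum_add_distrib]
    ring
  have h1 : |∑ i, tilt (τ - σ) i * c.b i s| ≤ ‖τ - σ‖ * ∑ i, c.b i s := by
    rw [Finset.mul_sum]
    refine (Finset.abs_sum_le_sum_abs _ _).trans (Finset.sum_le_sum fun i _ => ?_)
    rw [abs_mul, abs_of_nonneg (c.b_nonneg i s)]
    refine mul_le_mul_of_nonneg_right ((abs_tilt_le _ i).trans ?_) (c.b_nonneg i s)
    linarith [norm_nonneg (τ - σ)]
  rw [e]
  refine (abs_add_le _ _).trans ?_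
  rw [abs_mul, abs_of_nonneg hε]
  have := mul_le_mul_of_nonneg_left h1 hε
  linarith [c.abs_remainder_sub_le hε τ σ s]

theorem integral_sum_b_le : ∫ s in 0..Real.pi, ∑ i, c.b i s ≤ m := by
  rw [intervalIntegral.integral_finsetSum
    fun i _ => (c.continuous_b i).intervalIntegrable _ _]
  exact c.mass_le

theorem continuous_sum_b : Continuous fun s => ∑ i, c.b i s :=
  continuous_finsetSum _ fun i _ => c.continuous_b i

/-- The constant 5 is 1 for the direct change of the bump weights and 4 for the compensating change
of the four gaps. -/
theorem abs_position_sub_le (hε : 0 ≤ ε) (τ σ : ℝ × ℂ) {s : ℝ} (hs : s ∈ Set.Icc 0 Real.pi) :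
    |c.position τ s - c.position σ s| ≤ 5 * ε * m * ‖τ - σ‖ := by
  set h : ℝ → ℝ := fun t => ‖τ - σ‖ * (ε * ∑ i, c.b i t + ε * m * c.β t) with hh
  have hc : Continuous h := continuous_const.mul ((continuous_const.mul c.continuous_sum_b).add
    (continuous_const.mul c.continuous_β))
  have h1 : |c.position τ s - c.position σ s| ≤ ∫ t in 0..s, h t :=
    norm_integral_sub_le_of_le_on_Icc hs.1 (c.continuous_density τ) (c.continuous_density σ) hc
      fun t _ => c.abs_density_sub_le hε τ σ t
  have hm := c.mass_nonneg
  have hnn : ∀ t, 0 ≤ h t := fun t => mul_nonneg (norm_nonneg _) (add_nonneg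
    (mul_nonneg hε (Finset.sum_nonneg fun i _ => c.b_nonneg i t))
    (mul_nonneg (mul_nonneg hε hm) (c.β_nonneg t)))
  have h2 : ∫ t in 0..s, h t ≤ ∫ t in 0..Real.pi, h t :=
    intervalIntegral.integral_mono_interval le_rfl hs.1 hs.2
      (Filter.Eventually.of_forall hnn) (hc.intervalIntegrable _ _)
  have h3 : ∫ t in 0..Real.pi, h t =
      ‖τ - σ‖ * (ε * (∫ t in 0..Real.pi, ∑ i, c.b i t) + ε * m * 4) := by
    rw [hh, intervalIntegral.integral_const_mul, intervalIntegral.integral_add,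
      intervalIntegral.integral_const_mul, intervalIntegral.integral_const_mul, c.integral_β]
    · exact (continuous_const.mul c.continuous_sum_b).intervalIntegrable _ _
    · exact (continuous_const.mul c.continuous_β).intervalIntegrable _ _
  have h4 := mul_le_mul_of_nonneg_left
    (mul_le_mul_of_nonneg_left c.integral_sum_b_le hε) (norm_nonneg (τ - σ))
  linarith

theorem norm_phase_sub_le (hε : 0 ≤ ε) (τ σ : ℝ × ℂ) {s : ℝ} (hs : s ∈ Set.Icc 0 Real.pi) :
    ‖c.phase τ s - c.phase σ s‖ ≤ 10 * ε * m * ‖τ - σ‖ := by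
  refine (norm_cexp_sub_cexp_le _ _).trans ?_
  linarith [c.abs_position_sub_le hε τ σ hs]

theorem norm_phase_sub_I_pow_le (hε : 0 ≤ ε) (hε1 : ε ≤ 1) {τ : ℝ × ℂ} (hτ : ‖τ‖ ≤ 1)
    {i : Fin 4} {s : ℝ} (hs : s ∈ Set.Icc 0 Real.pi) (hb : c.b i s ≠ 0) :
    ‖c.phase τ s - Complex.I ^ (i : ℕ)‖ ≤ 2 * (ε * (2 * Real.pi + 4 * m)) := by
  rw [I_pow_eq_cexp]
  refine (norm_cexp_sub_cexp_le _ _).trans ?_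
  linarith [c.abs_position_sub_le_of_ne hε hε1 hτ hs hb]

theorem integral_abs_mul_sum_b (hF : Continuous F) :
    ∫ s in 0..Real.pi, |F s| * ∑ i, c.b i s = 4 := by
  simp only [Finset.mul_sum]
  rw [intervalIntegral.integral_finsetSum
    fun i _ => (hF.abs.fun_mul (c.continuous_b i)).intervalIntegrable _ _]
  simp [c.integral_b]

/-- Although the remainder carries most of the length, its mass weighted by |F| is of second order,
because `β` sits where |F| is at most of order ε². -/
theorem integral_abs_mul_remainder_bound_le (hF : Continuous F)
    (hK : ∀ s ∈ Set.Icc 0 Real.pi, |F s| ≤ K) :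
    ∫ s in 0..Real.pi, |F s| * (ε ^ 2 + c.β s) ≤ ε ^ 2 * (K * Real.pi + 4) := by
  have h1 : ∫ s in 0..Real.pi, |F s| ≤ K * Real.pi := by
    have := norm_integral_le_of_le_on_Icc (f := fun s => |F s|) Real.pi_pos.le
      (continuous_const (y := K)) fun s hs => by simpa using hK s hs
    have h2 := (le_abs_self _).trans this
    simpa [mul_comm] using h2
  simp only [mul_add]
  rw [intervalIntegral.integral_add ((hF.abs.fun_mul continuous_const).intervalIntegrable _ _)
    ((hF.abs.fun_mul c.continuous_β).intervalIntegrable _ _), intervalIntegral.integral_mul_const]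
  have h2 := c.integral_mul_β_le
  have := mul_le_mul_of_nonneg_right h1 (sq_nonneg ε)
  linarith

theorem abs_remainder_le (hε : 0 ≤ ε) (hε1 : ε ≤ 1) (hεm : ε * (Real.pi + 2 * m) ≤ Real.pi)
    {τ : ℝ × ℂ} (hτ : ‖τ‖ ≤ 1) (s : ℝ) : |c.remainder τ s| ≤ ε ^ 2 + c.β s := by
  have h1 := mul_nonneg (c.gapMass_nonneg hε hε1 hεm hτ) (c.β_nonneg s)
  have h2 := mul_le_mul_of_nonneg_right (c.gapMass_le_one hε hτ) (c.β_nonneg s)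
  unfold remainder
  rw [abs_of_nonneg (by positivity)]
  linarith

/-- The majorant does not depend on `τ`, and its integral is O(ε) by `integral_major_le`. -/
theorem abs_mul_density_le (hε : 0 ≤ ε) (hε1 : ε ≤ 1) (hεm : ε * (Real.pi + 2 * m) ≤ Real.pi)
    {τ : ℝ × ℂ} (hτ : ‖τ‖ ≤ 1) (s : ℝ) :
    |F s * c.density τ s| ≤ 2 * ε * (|F s| * ∑ i, c.b i s) + |F s| * (ε ^ 2 + c.β s) := by
  have h1 : |∑ i, (1 + tilt τ i) * c.b i s| ≤ 2 * ∑ i, c.b i s := by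
    rw [Finset.mul_sum]
    refine (Finset.abs_sum_le_sum_abs _ _).trans (Finset.sum_le_sum fun i _ => ?_)
    rw [abs_mul, abs_of_nonneg (c.b_nonneg i s)]
    exact mul_le_mul_of_nonneg_right (abs_one_add_tilt_le hτ i) (c.b_nonneg i s)
  have h2 : |c.density τ s| ≤ ε * (2 * ∑ i, c.b i s) + (ε ^ 2 + c.β s) := by
    refine (abs_add_le _ _).trans (add_le_add ?_ (c.abs_remainder_le hε hε1 hεm hτ s))
    rw [abs_mul, abs_of_nonneg hε]
    exact mul_le_mul_of_nonneg_left h1 hε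
  rw [abs_mul]
  have := mul_le_mul_of_nonneg_left h2 (abs_nonneg (F s))
  linarith

theorem continuous_major (hF : Continuous F) : Continuous fun s =>
    2 * ε * (|F s| * ∑ i, c.b i s) + |F s| * (ε ^ 2 + c.β s) :=
  (continuous_const.fun_mul (hF.abs.fun_mul c.continuous_sum_b)).add
    (hF.abs.fun_mul (continuous_const.fun_add c.continuous_β))

theorem integral_major_le (hF : Continuous F) (hK : ∀ s ∈ Set.Icc 0 Real.pi, |F s| ≤ K) :
    ∫ s in 0..Real.pi, (2 * ε * (|F s| * ∑ i, c.b i s) + |F s| * (ε ^ 2 + c.β s)) ≤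
      8 * ε + ε ^ 2 * (K * Real.pi + 4) := by
  rw [intervalIntegral.integral_add
    ((continuous_const.fun_mul (hF.abs.fun_mul c.continuous_sum_b)).intervalIntegrable _ _)
    ((hF.abs.fun_mul (continuous_const.fun_add c.continuous_β)).intervalIntegrable _ _),
    intervalIntegral.integral_const_mul, c.integral_abs_mul_sum_b hF]
  linarith [c.integral_abs_mul_remainder_bound_le hF hK]

theorem abs_mul_density_sub_le (hε : 0 ≤ ε) (τ σ : ℝ × ℂ) (s : ℝ) :
    |F s * c.density τ s - F s * c.density σ s| ≤
      ‖τ - σ‖ * (ε * (|F s| * ∑ i, c.b i s) + ε * m * (|F s| * c.β s)) := by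
  rw [← mul_sub, abs_mul]
  have := mul_le_mul_of_nonneg_left (c.abs_density_sub_le hε τ σ s) (abs_nonneg (F s))
  linarith

theorem continuous_minor (hF : Continuous F) : Continuous fun s =>
    ε * (|F s| * ∑ i, c.b i s) + ε * m * (|F s| * c.β s) :=
  (continuous_const.fun_mul (hF.abs.fun_mul c.continuous_sum_b)).add
    (continuous_const.fun_mul (hF.abs.fun_mul c.continuous_β))

theorem integral_minor_le (hε : 0 ≤ ε) (hF : Continuous F) :
    ∫ s in 0..Real.pi, (ε * (|F s| * ∑ i, c.b i s) + ε * m * (|F s| * c.β s)) ≤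
      4 * ε + 4 * m * ε ^ 3 := by
  rw [intervalIntegral.integral_add
    ((continuous_const.fun_mul (hF.abs.fun_mul c.continuous_sum_b)).intervalIntegrable _ _)
    ((continuous_const.fun_mul (hF.abs.fun_mul c.continuous_β)).intervalIntegrable _ _),
    intervalIntegral.integral_const_mul, intervalIntegral.integral_const_mul,
    c.integral_abs_mul_sum_b hF]
  have := mul_le_mul_of_nonneg_left c.integral_mul_β_le (mul_nonneg hε c.mass_nonneg)
  linarith

/-! ### The mean and the second Fourier coefficient, with their errors. -/

/-- The part of the mean of `F` due to the remainder of the density. -/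
def meanError (τ : ℝ × ℂ) : ℝ := ∫ s in 0..Real.pi, F s * c.remainder τ s

/-- The part of the second Fourier coefficient due to the remainder of the density and to the
variation of the phase on the bumps. -/
def fourierError (τ : ℝ × ℂ) : ℂ :=
  (∫ s in 0..Real.pi, ((F s * c.remainder τ s : ℝ) : ℂ) * c.phase τ s) +
    ε * ∑ i : Fin 4, ((1 + tilt τ i : ℝ) : ℂ) *
      ∫ s in 0..Real.pi, ((F s * c.b i s : ℝ) : ℂ) * (c.phase τ s - Complex.I ^ (i : ℕ))

theorem integral_mul_b (i : Fin 4) :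
    ∫ s in 0..Real.pi, F s * c.b i s = (-1) ^ (i : ℕ) := by
  rw [intervalIntegral.integral_congr (g := fun s => (-1) ^ (i : ℕ) * (|F s| * c.b i s)),
    intervalIntegral.integral_const_mul, c.integral_b, mul_one]
  intro s hs
  rw [Set.uIcc_of_le Real.pi_pos.le] at hs
  exact c.mul_b i s hs

theorem integral_mul_density (hF : Continuous F) (τ : ℝ × ℂ) :
    ∫ s in 0..Real.pi, F s * c.density τ s = ε * τ.1 + c.meanError τ := by
  have e : ∀ s, F s * c.density τ s =
      ε * (∑ i, (1 + tilt τ i) * (F s * c.b i s)) + F s * c.remainder τ s := by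
    intro s
    unfold density
    rw [mul_add, mul_left_comm, Finset.mul_sum]
    simp only [mul_left_comm]
  have hi : ∀ i ∈ Finset.univ, IntervalIntegrable (fun s => (1 + tilt τ i) * (F s * c.b i s))
      MeasureTheory.volume 0 Real.pi := fun i _ =>
    (continuous_const.fun_mul (hF.fun_mul (c.continuous_b i))).intervalIntegrable _ _
  simp only [e]
  rw [intervalIntegral.integral_add, intervalIntegral.integral_const_mul,
    intervalIntegral.integral_finsetSum hi]
  · simp only [intervalIntegral.integral_const_mul, c.integral_mul_b, meanError]
    rw [← sum_sign_tilt τ]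
    simp only [mul_comm]
  · exact (continuous_const.fun_mul (continuous_finsetSum _ fun i _ =>
      continuous_const.fun_mul (hF.fun_mul (c.continuous_b i)))).intervalIntegrable _ _
  · exact (hF.fun_mul (c.continuous_remainder τ)).intervalIntegrable _ _

/-- The phase on the i-th bump is replaced by I^i. This gives the leading term through
`sum_sign_tilt_I`, and the difference is part of `fourierError`. -/
theorem integral_mul_density_phase (hF : Continuous F) (τ : ℝ × ℂ) :
    ∫ s in 0..Real.pi, ((F s * c.density τ s : ℝ) : ℂ) * c.phase τ s =
      ε * τ.2 + c.fourierError τ := by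
  have hp := c.continuous_phase τ
  have cb : ∀ i, Continuous fun s => ((F s * c.b i s : ℝ) : ℂ) := fun i =>
    Complex.continuous_ofReal.comp (hF.fun_mul (c.continuous_b i))
  have cr : Continuous fun s => ((F s * c.remainder τ s : ℝ) : ℂ) * c.phase τ s :=
    (Complex.continuous_ofReal.comp (hF.fun_mul (c.continuous_remainder τ))).fun_mul hp
  have e : ∀ s, ((F s * c.density τ s : ℝ) : ℂ) * c.phase τ s =
      ε * (∑ i : Fin 4, ((1 + tilt τ i : ℝ) : ℂ) * (((F s * c.b i s : ℝ) : ℂ) * c.phase τ s)) +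
        ((F s * c.remainder τ s : ℝ) : ℂ) * c.phase τ s := by
    intro s
    unfold density
    simp only [Fin.sum_univ_four]
    push_cast
    ring
  have hi : ∀ i ∈ Finset.univ, IntervalIntegrable
      (fun s => ((1 + tilt τ i : ℝ) : ℂ) * (((F s * c.b i s : ℝ) : ℂ) * c.phase τ s))
      MeasureTheory.volume 0 Real.pi := fun i _ =>
    (continuous_const.fun_mul ((cb i).fun_mul hp)).intervalIntegrable _ _
  have hb : ∀ i : Fin 4, ∫ s in 0..Real.pi, ((F s * c.b i s : ℝ) : ℂ) * c.phase τ s =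
      (∫ s in 0..Real.pi, ((F s * c.b i s : ℝ) : ℂ) * (c.phase τ s - Complex.I ^ (i : ℕ))) +
        (((-1) ^ (i : ℕ) : ℝ) : ℂ) * Complex.I ^ (i : ℕ) := by
    intro i
    simp only [mul_sub]
    rw [intervalIntegral.integral_sub (((cb i).fun_mul hp).intervalIntegrable _ _)
      (((cb i).fun_mul continuous_const).intervalIntegrable _ _),
      intervalIntegral.integral_mul_const, intervalIntegral.integral_ofReal, c.integral_mul_b]
    ring
  simp only [e]
  rw [intervalIntegral.integral_add, intervalIntegral.integral_const_mul,
    intervalIntegral.integral_finsetSum hi]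
  · simp only [intervalIntegral.integral_const_mul, hb, fourierError]
    rw [← sum_sign_tilt_I τ]
    simp only [Fin.sum_univ_four]
    push_cast
    ring
  · exact (continuous_const.fun_mul (continuous_finsetSum _ fun i _ =>
      continuous_const.fun_mul ((cb i).fun_mul hp))).intervalIntegrable _ _
  · exact cr.intervalIntegrable _ _

theorem abs_meanError_le (hε : 0 ≤ ε) (hε1 : ε ≤ 1) (hεm : ε * (Real.pi + 2 * m) ≤ Real.pi)
    (hF : Continuous F) (hK : ∀ s ∈ Set.Icc 0 Real.pi, |F s| ≤ K) {τ : ℝ × ℂ} (hτ : ‖τ‖ ≤ 1) :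
    |c.meanError τ| ≤ ε ^ 2 * (K * Real.pi + 4) := by
  refine (norm_integral_le_of_le_on_Icc (f := fun s => F s * c.remainder τ s) Real.pi_pos.le
    (hF.abs.fun_mul (continuous_const.fun_add c.continuous_β)) fun s _ => ?_).trans
    (c.integral_abs_mul_remainder_bound_le hF hK)
  rw [Real.norm_eq_abs, abs_mul]
  exact mul_le_mul_of_nonneg_left (c.abs_remainder_le hε hε1 hεm hτ s) (abs_nonneg _)

/-- The parameter enters the remainder only through `gapMass`, at order ε, and |F| β has integral
O(ε²). -/
theorem abs_meanError_sub_le (hε : 0 ≤ ε) (hF : Continuous F) (τ σ : ℝ × ℂ) :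
    |c.meanError τ - c.meanError σ| ≤ 4 * ε ^ 3 * m * ‖τ - σ‖ := by
  have hc : Continuous fun s => ‖τ - σ‖ * (ε * m) * (|F s| * c.β s) :=
    continuous_const.fun_mul (hF.abs.fun_mul c.continuous_β)
  refine (norm_integral_sub_le_of_le_on_Icc Real.pi_pos.le
    (hF.fun_mul (c.continuous_remainder τ)) (hF.fun_mul (c.continuous_remainder σ)) hc
    fun s _ => ?_).trans ?_
  · rw [Real.norm_eq_abs, ← mul_sub, abs_mul]
    have := mul_le_mul_of_nonneg_left (c.abs_remainder_sub_le hε τ σ s) (abs_nonneg (F s))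
    linarith
  · rw [intervalIntegral.integral_const_mul]
    have := mul_le_mul_of_nonneg_left c.integral_mul_β_le
      (mul_nonneg (norm_nonneg (τ - σ)) (mul_nonneg hε c.mass_nonneg))
    linarith

theorem norm_integral_b_phase_sub_le (hε : 0 ≤ ε) (hε1 : ε ≤ 1) (hF : Continuous F) {τ : ℝ × ℂ}
    (hτ : ‖τ‖ ≤ 1) (i : Fin 4) :
    ‖∫ s in 0..Real.pi, ((F s * c.b i s : ℝ) : ℂ) * (c.phase τ s - Complex.I ^ (i : ℕ))‖ ≤
      2 * (ε * (2 * Real.pi + 4 * m)) := by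
  refine (norm_integral_le_of_le_on_Icc Real.pi_pos.le
    ((continuous_const (y := 2 * (ε * (2 * Real.pi + 4 * m)))).fun_mul
      (hF.abs.fun_mul (c.continuous_b i))) fun s hs => ?_).trans ?_
  · rw [norm_mul, Complex.norm_real, Real.norm_eq_abs, abs_mul, abs_of_nonneg (c.b_nonneg i s),
      mul_comm]
    by_cases hb : c.b i s = 0
    · simp [hb]
    · exact mul_le_mul_of_nonneg_right (c.norm_phase_sub_I_pow_le hε hε1 hτ hs hb)
        (mul_nonneg (abs_nonneg _) (c.b_nonneg i s))
  · rw [intervalIntegral.integral_const_mul, c.integral_b, mul_one]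

theorem norm_integral_b_phase_sub_sub_le (hε : 0 ≤ ε) (hF : Continuous F) (τ σ : ℝ × ℂ)
    (i : Fin 4) :
    ‖(∫ s in 0..Real.pi, ((F s * c.b i s : ℝ) : ℂ) * (c.phase τ s - Complex.I ^ (i : ℕ))) -
      ∫ s in 0..Real.pi, ((F s * c.b i s : ℝ) : ℂ) * (c.phase σ s - Complex.I ^ (i : ℕ))‖ ≤
      10 * ε * m * ‖τ - σ‖ := by
  have cb : Continuous fun s => ((F s * c.b i s : ℝ) : ℂ) :=
    Complex.continuous_ofReal.comp (hF.fun_mul (c.continuous_b i))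
  refine (norm_integral_sub_le_of_le_on_Icc Real.pi_pos.le
    (cb.fun_mul ((c.continuous_phase τ).fun_sub continuous_const))
    (cb.fun_mul ((c.continuous_phase σ).fun_sub continuous_const))
    ((continuous_const (y := 10 * ε * m * ‖τ - σ‖)).fun_mul
      (hF.abs.fun_mul (c.continuous_b i))) fun s hs => ?_).trans ?_
  · rw [← mul_sub, sub_sub_sub_cancel_right, norm_mul, Complex.norm_real, Real.norm_eq_abs,
      abs_mul, abs_of_nonneg (c.b_nonneg i s), mul_comm]
    exact mul_le_mul_of_nonneg_right (c.norm_phase_sub_le hε τ σ hs)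
      (mul_nonneg (abs_nonneg _) (c.b_nonneg i s))
  · rw [intervalIntegral.integral_const_mul, c.integral_b, mul_one]

theorem norm_integral_remainder_phase_sub_le (hε : 0 ≤ ε) (hε1 : ε ≤ 1)
    (hεm : ε * (Real.pi + 2 * m) ≤ Real.pi) (hF : Continuous F)
    (hK : ∀ s ∈ Set.Icc 0 Real.pi, |F s| ≤ K) (τ : ℝ × ℂ) {σ : ℝ × ℂ} (hσ : ‖σ‖ ≤ 1) :
    ‖(∫ s in 0..Real.pi, ((F s * c.remainder τ s : ℝ) : ℂ) * c.phase τ s) -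
      ∫ s in 0..Real.pi, ((F s * c.remainder σ s : ℝ) : ℂ) * c.phase σ s‖ ≤
      (4 * ε ^ 3 * m + 10 * ε ^ 3 * m * (K * Real.pi + 4)) * ‖τ - σ‖ := by
  have cr : ∀ τ, Continuous fun s => ((F s * c.remainder τ s : ℝ) : ℂ) * c.phase τ s := fun τ =>
    (Complex.continuous_ofReal.comp (hF.fun_mul (c.continuous_remainder τ))).fun_mul (c.continuous_phase τ)
  have c1 : Continuous fun s => ‖τ - σ‖ * (ε * m) * (|F s| * c.β s) :=
    continuous_const.fun_mul (hF.abs.fun_mul c.continuous_β)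
  have c2 : Continuous fun s => 10 * ε * m * ‖τ - σ‖ * (|F s| * (ε ^ 2 + c.β s)) :=
    continuous_const.fun_mul (hF.abs.fun_mul (continuous_const.fun_add c.continuous_β))
  refine (norm_integral_sub_le_of_le_on_Icc Real.pi_pos.le (cr τ) (cr σ) (c1.fun_add c2)
    fun s hs => ?_).trans ?_
  · have e : ((F s * c.remainder τ s : ℝ) : ℂ) * c.phase τ s -
        ((F s * c.remainder σ s : ℝ) : ℂ) * c.phase σ s =
        ((F s * (c.remainder τ s - c.remainder σ s) : ℝ) : ℂ) * c.phase τ s +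
          ((F s * c.remainder σ s : ℝ) : ℂ) * (c.phase τ s - c.phase σ s) := by
      push_cast
      ring
    rw [e]
    refine (norm_add_le _ _).trans (add_le_add ?_ ?_)
    · rw [norm_mul, c.norm_phase, mul_one, Complex.norm_real, Real.norm_eq_abs, abs_mul]
      have := mul_le_mul_of_nonneg_left (c.abs_remainder_sub_le hε τ σ s) (abs_nonneg (F s))
      linarith
    · rw [norm_mul, Complex.norm_real, Real.norm_eq_abs, abs_mul, mul_comm]
      have h1 := mul_le_mul_of_nonneg_left (c.abs_remainder_le hε hε1 hεm hσ s) (abs_nonneg (F s))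
      exact mul_le_mul (c.norm_phase_sub_le hε τ σ hs) h1 (by positivity)
        ((norm_nonneg _).trans (c.norm_phase_sub_le hε τ σ hs))
  · rw [intervalIntegral.integral_add (c1.intervalIntegrable _ _) (c2.intervalIntegrable _ _),
      intervalIntegral.integral_const_mul, intervalIntegral.integral_const_mul]
    have h0 : 0 ≤ ‖τ - σ‖ * (ε * m) :=
      mul_nonneg (norm_nonneg (τ - σ)) (mul_nonneg hε c.mass_nonneg)
    have h1 := mul_le_mul_of_nonneg_left c.integral_mul_β_le h0
    have h2 := mul_le_mul_of_nonneg_left (c.integral_abs_mul_remainder_bound_le hF hK) h0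
    linarith

/-- The remainder is of second order when weighted by |F|. On the bumps one factor ε is their mass
and the other is the deviation of the phase from I^i. -/
theorem norm_fourierError_le (hε : 0 ≤ ε) (hε1 : ε ≤ 1) (hεm : ε * (Real.pi + 2 * m) ≤ Real.pi)
    (hF : Continuous F) (hK : ∀ s ∈ Set.Icc 0 Real.pi, |F s| ≤ K) {τ : ℝ × ℂ} (hτ : ‖τ‖ ≤ 1) :
    ‖c.fourierError τ‖ ≤ ε ^ 2 * (K * Real.pi + 4 + 16 * (2 * Real.pi + 4 * m)) := by
  have h1 : ‖∫ s in 0..Real.pi, ((F s * c.remainder τ s : ℝ) : ℂ) * c.phase τ s‖ ≤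
      ε ^ 2 * (K * Real.pi + 4) := by
    refine (norm_integral_le_of_le_on_Icc Real.pi_pos.le
      (hF.abs.fun_mul (continuous_const.fun_add c.continuous_β)) fun s _ => ?_).trans
      (c.integral_abs_mul_remainder_bound_le hF hK)
    rw [norm_mul, c.norm_phase, mul_one, Complex.norm_real, Real.norm_eq_abs, abs_mul]
    exact mul_le_mul_of_nonneg_left (c.abs_remainder_le hε hε1 hεm hτ s) (abs_nonneg _)
  have h2 : ‖∑ i : Fin 4, ((1 + tilt τ i : ℝ) : ℂ) *
      ∫ s in 0..Real.pi, ((F s * c.b i s : ℝ) : ℂ) * (c.phase τ s - Complex.I ^ (i : ℕ))‖ ≤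
      ∑ _i : Fin 4, 2 * (2 * (ε * (2 * Real.pi + 4 * m))) := by
    refine norm_sum_le_of_le _ fun i _ => ?_
    rw [norm_mul, Complex.norm_real]
    exact mul_le_mul (abs_one_add_tilt_le hτ i) (c.norm_integral_b_phase_sub_le hε hε1 hF hτ i)
      (norm_nonneg _) zero_le_two
  simp only [Finset.sum_const, Finset.card_univ, Fintype.card_fin, nsmul_eq_mul] at h2
  rw [Nat.cast_ofNat] at h2
  refine (norm_add_le _ _).trans ?_
  rw [norm_mul, Complex.norm_real, Real.norm_eq_abs, abs_of_nonneg hε]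
  have := mul_le_mul_of_nonneg_left h2 hε
  linarith

/-- Products are differenced factor by factor. A change of weight multiplies a phase deviation O(ε),
and a change of phase is itself O(ε ‖τ - σ‖); the outer ε makes both second order. -/
theorem norm_fourierError_sub_le (hε : 0 ≤ ε) (hε1 : ε ≤ 1)
    (hεm : ε * (Real.pi + 2 * m) ≤ Real.pi) (hF : Continuous F)
    (hK : ∀ s ∈ Set.Icc 0 Real.pi, |F s| ≤ K) {τ σ : ℝ × ℂ} (hτ : ‖τ‖ ≤ 1) (hσ : ‖σ‖ ≤ 1) :
    ‖c.fourierError τ - c.fourierError σ‖ ≤ (4 * ε ^ 3 * m + 10 * ε ^ 3 * m * (K * Real.pi + 4) +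
      ε ^ 2 * (6 * (2 * Real.pi + 4 * m) + 80 * m)) * ‖τ - σ‖ := by
  have h1 := c.norm_integral_remainder_phase_sub_le hε hε1 hεm hF hK τ hσ
  set J : ℝ × ℂ → Fin 4 → ℂ := fun τ i =>
    ∫ s in 0..Real.pi, ((F s * c.b i s : ℝ) : ℂ) * (c.phase τ s - Complex.I ^ (i : ℕ)) with hJ
  have h2 : ‖∑ i : Fin 4, (((1 + tilt τ i : ℝ) : ℂ) * J τ i - ((1 + tilt σ i : ℝ) : ℂ) * J σ i)‖ ≤
      ∑ _i : Fin 4, (3 / 4 * ‖τ - σ‖ * (2 * (ε * (2 * Real.pi + 4 * m))) +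
        2 * (10 * ε * m * ‖τ - σ‖)) := by
    refine norm_sum_le_of_le _ fun i _ => ?_
    have e : ((1 + tilt τ i : ℝ) : ℂ) * J τ i - ((1 + tilt σ i : ℝ) : ℂ) * J σ i =
        ((tilt (τ - σ) i : ℝ) : ℂ) * J τ i + ((1 + tilt σ i : ℝ) : ℂ) * (J τ i - J σ i) := by
      rw [tilt_sub]
      push_cast
      ring
    rw [e]
    refine (norm_add_le _ _).trans (add_le_add ?_ ?_)
    · rw [norm_mul, Complex.norm_real]
      exact mul_le_mul (abs_tilt_le _ i) (c.norm_integral_b_phase_sub_le hε hε1 hF hτ i)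
        (norm_nonneg _) (by positivity)
    · rw [norm_mul, Complex.norm_real]
      exact mul_le_mul (abs_one_add_tilt_le hσ i) (c.norm_integral_b_phase_sub_sub_le hε hF τ σ i)
        (norm_nonneg _) zero_le_two
  have e : c.fourierError τ - c.fourierError σ =
      ((∫ s in 0..Real.pi, ((F s * c.remainder τ s : ℝ) : ℂ) * c.phase τ s) -
        ∫ s in 0..Real.pi, ((F s * c.remainder σ s : ℝ) : ℂ) * c.phase σ s) +
      ε * ∑ i : Fin 4, (((1 + tilt τ i : ℝ) : ℂ) * J τ i - ((1 + tilt σ i : ℝ) : ℂ) * J σ i) := by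
    rw [Finset.sum_sub_distrib]
    unfold fourierError
    ring
  simp only [Finset.sum_const, Finset.card_univ, Fintype.card_fin, nsmul_eq_mul] at h2
  rw [Nat.cast_ofNat] at h2
  rw [e]
  refine (norm_add_le _ _).trans ?_
  rw [norm_mul, Complex.norm_real, Real.norm_eq_abs, abs_of_nonneg hε]
  have := mul_le_mul_of_nonneg_left h2 hε
  linarith

end BumpConfig

/-! ### Periodic extension, a fixed point argument and the conserved form. -/

section PeriodicSolution

variable {E : Type*} [NormedAddCommGroup E] [NormedSpace ℝ E] [CompleteSpace E] {a b : ℝ}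

theorem hasDerivAt_const_add_volterra (hab : a ≤ b) (A : C(ℝ, E →L[ℝ] E))
    (V : C(Set.Icc a b, E)) (v : E) (s : ℝ) :
    HasDerivAt (fun s => v + ∫ t in a..s, A t (V (Set.projIcc a b hab t)))
      (A s (V (Set.projIcc a b hab s))) s := by
  have hc := continuous_volterra_integrand hab A V
  exact (intervalIntegral.integral_hasDerivAt_right (hc.intervalIntegrable _ _)
    (hc.stronglyMeasurableAtFilter _ _) hc.continuousAt).const_add v

/-- A solution on one period of a periodic linear equation with equal values at the ends extends
to a periodic solution. -/
theorem exists_periodic_extension {T : ℝ} (hT : 0 < T) {A : C(ℝ, E →L[ℝ] E)}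
    (hA : Function.Periodic A T) {V : C(Set.Icc 0 T, E)} {v : E}
    (hV : V = ContinuousMap.const _ v + volterra hT.le A V)
    (hVT : V ⟨T, Set.right_mem_Icc.2 hT.le⟩ = v) :
    ∃ U : ℝ → E, Function.Periodic U T ∧ U 0 = v ∧ (∀ s, HasDerivAt U (A s (U s)) s) ∧
      ∀ s, ∃ t, U s = V t := by
  have hV' : ∀ s, V s = v + ∫ t in 0..(s : ℝ), A t (V (Set.projIcc 0 T hT.le t)) := fun s =>
    congrArg (fun W : C(Set.Icc 0 T, E) => W s) hV
  have hV0 : V ⟨0, Set.left_mem_Icc.2 hT.le⟩ = v := by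
    rw [hV']
    simp
  have : Fact (0 < T) := ⟨hT⟩
  set W : ℝ → E := fun s => AddCircle.liftIco T 0 (fun t => V (Set.projIcc 0 T hT.le t)) (s : AddCircle T)
    with hW
  have hWper : Function.Periodic W T := fun s => by simp [hW]
  have hWIcc : ∀ s (hs : s ∈ Set.Icc 0 T), W s = V ⟨s, hs⟩ := by
    intro s hs
    rcases hs.2.lt_or_eq with h | h
    · have := AddCircle.liftIco_coe_apply (p := T) (a := 0)
        (f := fun t => V (Set.projIcc 0 T hT.le t)) (x := s) ⟨hs.1, by simpa using h⟩
      rw [hW]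
      simp only
      rw [this, Set.projIcc_of_mem hT.le hs]
    · subst h
      have := AddCircle.liftIco_coe_apply (p := s) (a := 0)
        (f := fun t => V (Set.projIcc 0 s hT.le t)) (x := 0) ⟨le_rfl, by simpa using hT⟩
      have h2 : W s = W 0 := by simpa using hWper 0
      rw [h2, hW]
      simp only
      rw [this, Set.projIcc_left, hVT, hV0]
  have hWc : Continuous W := by
    refine Continuous.comp (g := AddCircle.liftIco T 0 fun t => V (Set.projIcc 0 T hT.le t))
      (AddCircle.liftIco_continuous ?_ ?_) (AddCircle.continuous_mk' T)
    · rw [zero_add, Set.projIcc_left, Set.projIcc_right, hV0, hVT]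
    · exact (V.continuous.comp continuous_projIcc).continuousOn
  have hAW : Continuous fun t => A t (W t) := A.continuous.clm_apply hWc
  have hAWper : Function.Periodic (fun t => A t (W t)) T := fun s => by
    simp only [hWper s, hA s]
  have hint : ∀ x y, IntervalIntegrable (fun t => A t (W t)) MeasureTheory.volume x y :=
    fun x y => hAW.intervalIntegrable x y
  have hWint : ∀ s ∈ Set.Icc 0 T, W s = v + ∫ t in 0..s, A t (W t) := by
    intro s hs
    rw [hWIcc s hs, hV']
    congr 1
    apply intervalIntegral.integral_congr
    intro t ht
    rw [Set.uIcc_of_le hs.1] at ht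
    have ht' : t ∈ Set.Icc 0 T := ⟨ht.1, ht.2.trans hs.2⟩
    simp only
    rw [Set.projIcc_of_mem hT.le ht', hWIcc t ht']
  -- Equal end values make the integral of the derivative over a period vanish, so the integral
  -- equation, once known on [0, T], persists on the line. Differentiability at the multiples of T
  -- then needs no separate matching.
  have hzero : ∫ t in 0..T, A t (W t) = 0 := by
    have h1 := hWint T (Set.right_mem_Icc.2 hT.le)
    rw [hWIcc T (Set.right_mem_Icc.2 hT.le), hVT] at h1
    simpa using h1
  have hPper : Function.Periodic (fun s => v + ∫ t in 0..s, A t (W t)) T := by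
    intro s
    simp only
    rw [← intervalIntegral.integral_add_adjacent_intervals (hint 0 s) (hint s (s + T)),
      hAWper.intervalIntegral_add_eq s 0, zero_add, hzero, add_zero]
  have hrep : ∀ s : ℝ, ∃ t ∈ Set.Ico 0 T, W s = W t ∧
      (v + ∫ u in 0..s, A u (W u)) = v + ∫ u in 0..t, A u (W u) := by
    intro s
    obtain ⟨n, hn, -⟩ := existsUnique_sub_zsmul_mem_Ico hT s 0
    rw [zero_add] at hn
    exact ⟨_, hn, (hWper.sub_zsmul_eq n).symm, (hPper.sub_zsmul_eq n).symm⟩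
  have hall : ∀ s, W s = v + ∫ t in 0..s, A t (W t) := by
    intro s
    obtain ⟨t, ht, h1, h2⟩ := hrep s
    rw [h1, h2]
    exact hWint t ⟨ht.1, ht.2.le⟩
  refine ⟨W, hWper, ?_, ?_, ?_⟩
  · rw [hall]
    simp
  · intro s
    have hd := (intervalIntegral.integral_hasDerivAt_right (hint 0 s)
      (hAW.stronglyMeasurableAtFilter _ _) hAW.continuousAt).const_add v
    exact hd.congr_of_eventuallyEq (Filter.Eventually.of_forall hall)
  · intro s
    obtain ⟨t, ht, h1, -⟩ := hrep s
    exact ⟨⟨t, ht.1, ht.2.le⟩, by rw [h1, hWIcc t ⟨ht.1, ht.2.le⟩]⟩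

end PeriodicSolution

/-- The map x ↦ -f x sends the closed unit ball to itself, since 1/2 + 1/2 = 1, and contracts it. -/
theorem exists_add_eq_zero_of_lipschitz {E : Type*} [NormedAddCommGroup E] [CompleteSpace E]
    {f : E → E} (hf : ∀ x y, ‖x‖ ≤ 1 → ‖y‖ ≤ 1 → ‖f x - f y‖ ≤ 1 / 2 * ‖x - y‖)
    (h0 : ‖f 0‖ ≤ 1 / 2) : ∃ x, ‖x‖ ≤ 1 ∧ x + f x = 0 := by
  set s : Set E := Metric.closedBall 0 1 with hs
  have hmem : ∀ {x}, x ∈ s ↔ ‖x‖ ≤ 1 := by simp [hs]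
  have hmaps : Set.MapsTo (fun x => -f x) s s := by
    intro x hx
    rw [hmem] at hx ⊢
    have h1 := hf x 0 hx (by simp)
    rw [sub_zero] at h1
    have h2 := norm_le_norm_sub_add (f x) (f 0)
    rw [norm_neg]
    linarith
  have hc : ContractingWith (1 / 2) (hmaps.restrict (fun x => -f x) s s) := by
    refine ⟨by rw [← NNReal.coe_lt_coe]; norm_num, LipschitzWith.of_dist_le_mul fun x y => ?_⟩
    rw [Subtype.dist_eq, Subtype.dist_eq, Set.MapsTo.val_restrict_apply,
      Set.MapsTo.val_restrict_apply, dist_neg_neg, dist_eq_norm, dist_eq_norm]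
    simpa using hf x y (hmem.1 x.2) (hmem.1 y.2)
  obtain ⟨x, hx, hfix, -⟩ := hc.exists_fixedPoint' Metric.isClosed_closedBall.isComplete hmaps
    (x := 0) (hmem.2 (by simp)) (edist_ne_top _ _)
  refine ⟨x, hmem.1 hx, ?_⟩
  have : -f x = x := hfix
  exact add_eq_zero_iff_eq_neg.2 this.symm

theorem hillMatrix_add_pi (x : ℝ) : hillMatrix (x + Real.pi) = hillMatrix x := by
  have : Complex.exp (2 * ((x + Real.pi : ℝ) : ℂ) * Complex.I) = Complex.exp (2 * x * Complex.I) := by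
    rw [show 2 * ((x + Real.pi : ℝ) : ℂ) * Complex.I =
      2 * x * Complex.I + 2 * Real.pi * Complex.I by push_cast; ring, Complex.exp_add,
      Complex.exp_two_pi_mul_I, mul_one]
  ext v <;> simp only [hillMatrix_apply, this, ContinuousLinearMap.comp_apply]

/-- Hill's equation preserves the Hermitian form `|α|² - |β|²`. -/
theorem form_eq_one_of_volterra {A : C(ℝ, (ℂ × ℂ) →L[ℝ] (ℂ × ℂ))} {κ ψ : ℝ → ℝ}
    (hA : ∀ s, A s = κ s • hillMatrix (ψ s)) {T : ℝ} (hT : 0 < T)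
    {V : C(Set.Icc 0 T, ℂ × ℂ)}
    (hV : V = ContinuousMap.const _ (1, 0) + volterra hT.le A V) (s : Set.Icc 0 T) :
    Complex.normSq (V s).1 - Complex.normSq (V s).2 = 1 := by
  set U : ℝ → ℂ × ℂ := fun s => (1, 0) + ∫ t in 0..s, A t (V (Set.projIcc 0 T hT.le t)) with hU
  have hV' : ∀ s : Set.Icc 0 T, V s = U s := fun s =>
    congrArg (fun W : C(Set.Icc 0 T, ℂ × ℂ) => W s) hV
  have hUd : ∀ s ∈ Set.Icc 0 T, HasDerivAt U (A s (U s)) s := by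
    intro s hs
    have := hasDerivAt_const_add_volterra hT.le A V (1, 0) s
    rwa [Set.projIcc_of_mem hT.le hs, hV'] at this
  have hform : ∀ s ∈ Set.Icc 0 T,
      HasDerivAt (fun s => Complex.normSq (U s).1 - Complex.normSq (U s).2) 0 s := by
    intro s hs
    have h := hUd s hs
    have h1 : HasDerivAt (fun s => (U s).1) (A s (U s)).1 s :=
      (ContinuousLinearMap.fst ℝ ℂ ℂ).hasFDerivAt.comp_hasDerivAt s h
    have h2 : HasDerivAt (fun s => (U s).2) (A s (U s)).2 s :=
      (ContinuousLinearMap.snd ℝ ℂ ℂ).hasFDerivAt.comp_hasDerivAt s h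
    have r1 := Complex.reCLM.hasFDerivAt.comp_hasDerivAt s h1
    have i1 := Complex.imCLM.hasFDerivAt.comp_hasDerivAt s h1
    have r2 := Complex.reCLM.hasFDerivAt.comp_hasDerivAt s h2
    have i2 := Complex.imCLM.hasFDerivAt.comp_hasDerivAt s h2
    have h3 := ((r1.fun_mul r1).fun_add (i1.fun_mul i1)).fun_sub
      ((r2.fun_mul r2).fun_add (i2.fun_mul i2))
    refine (h3.congr_deriv ?_)
    rw [hA]
    simp [hillMatrix_apply]
    ring
  have hc : ∀ s ∈ Set.Icc 0 T, Complex.normSq (U s).1 - Complex.normSq (U s).2 =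
      Complex.normSq (U 0).1 - Complex.normSq (U 0).2 :=
    constant_of_has_deriv_right_zero
      (fun s hs => (hform s hs).continuousAt.continuousWithinAt)
      fun s hs => (hform s ⟨hs.1, hs.2.le⟩).hasDerivWithinAt
  rw [hV', hc s s.2]
  simp [hU]

/-! ### Choosing the parameter that makes the monodromy trivial. -/

namespace BumpConfig

variable {F : ℝ → ℝ} {ε m K : ℝ} (c : BumpConfig F ε m)

/-- The coefficient of Hill's equation after the reparametrization with parameter `τ`. -/
def coefficient (hF : Continuous F) (τ : ℝ × ℂ) : C(ℝ, (ℂ × ℂ) →L[ℝ] (ℂ × ℂ)) where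
  toFun s := (F s * c.density τ s) • hillMatrix (c.position τ s)
  continuous_toFun := (hF.mul (c.continuous_density τ)).smul
    (continuous_hillMatrix.comp (c.continuous_position τ))

theorem norm_coefficient_le (hF : Continuous F) (hε : 0 ≤ ε) (hε1 : ε ≤ 1)
    (hεm : ε * (Real.pi + 2 * m) ≤ Real.pi) {τ : ℝ × ℂ} (hτ : ‖τ‖ ≤ 1) (s : ℝ) :
    ‖c.coefficient hF τ s‖ ≤
      1 / 2 * (2 * ε * (|F s| * ∑ i, c.b i s) + |F s| * (ε ^ 2 + c.β s)) := by
  change ‖(F s * c.density τ s) • hillMatrix (c.position τ s)‖ ≤ _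
  rw [norm_smul, mul_comm]
  exact mul_le_mul (norm_hillMatrix_le _) (c.abs_mul_density_le hε hε1 hεm hτ s) (norm_nonneg _)
    (by norm_num)

theorem norm_coefficient_sub_le (hF : Continuous F) (hε : 0 ≤ ε) (hε1 : ε ≤ 1)
    (hεm : ε * (Real.pi + 2 * m) ≤ Real.pi) (τ : ℝ × ℂ) {σ : ℝ × ℂ} (hσ : ‖σ‖ ≤ 1)
    {s : ℝ} (hs : s ∈ Set.Icc 0 Real.pi) :
    ‖c.coefficient hF τ s - c.coefficient hF σ s‖ ≤
      ‖τ - σ‖ * (1 / 2 * (ε * (|F s| * ∑ i, c.b i s) + ε * m * (|F s| * c.β s)) +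
        5 / 2 * ε * m * (2 * ε * (|F s| * ∑ i, c.b i s) + |F s| * (ε ^ 2 + c.β s))) := by
  change ‖(F s * c.density τ s) • hillMatrix (c.position τ s) -
    (F s * c.density σ s) • hillMatrix (c.position σ s)‖ ≤ _
  have e : (F s * c.density τ s) • hillMatrix (c.position τ s) -
      (F s * c.density σ s) • hillMatrix (c.position σ s) =
      (F s * c.density τ s - F s * c.density σ s) • hillMatrix (c.position τ s) +
      (F s * c.density σ s) • (hillMatrix (c.position τ s) - hillMatrix (c.position σ s)) := by
    module
  rw [e]
  refine (norm_add_le _ _).trans ?_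
  rw [norm_smul, norm_smul, Real.norm_eq_abs, Real.norm_eq_abs]
  have h1 := mul_le_mul (c.abs_mul_density_sub_le hε τ σ s)
    (norm_hillMatrix_le (c.position τ s)) (norm_nonneg _)
    ((abs_nonneg _).trans (c.abs_mul_density_sub_le hε τ σ s))
  have h2 := c.abs_position_sub_le hε τ σ hs
  have h3 : ‖hillMatrix (c.position τ s) - hillMatrix (c.position σ s)‖ ≤
      1 / 2 * (5 * ε * m * ‖τ - σ‖) :=
    (norm_hillMatrix_sub_le _ _).trans (mul_le_mul_of_nonneg_left h2 (by norm_num))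
  have h4 := mul_le_mul (c.abs_mul_density_le hε hε1 hεm hσ s) h3 (norm_nonneg _)
    ((abs_nonneg _).trans (c.abs_mul_density_le hε hε1 hεm hσ s))
  linarith

theorem continuous_coefficient_apply (hF : Continuous F) (τ : ℝ × ℂ) (v : ℂ × ℂ) :
    Continuous fun s => c.coefficient hF τ s v :=
  (c.coefficient hF τ).continuous.clm_apply continuous_const

/-- The first Picard correction at π consists exactly of the mean and the second Fourier coefficient
of the potential. -/
theorem volterra_coefficient_const (hF : Continuous F) (τ : ℝ × ℂ) :
    volterra Real.pi_pos.le (c.coefficient hF τ) (ContinuousMap.const _ (1, 0))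
      ⟨Real.pi, Set.right_mem_Icc.2 Real.pi_pos.le⟩ =
      (Complex.I / 4 * ((ε * τ.1 + c.meanError τ : ℝ) : ℂ),
        -(Complex.I / 4) * (ε * τ.2 + c.fourierError τ)) := by
  have h : ∀ s, c.coefficient hF τ s (1, 0) =
      (Complex.I / 4 * ((F s * c.density τ s : ℝ) : ℂ),
        -(Complex.I / 4) * (((F s * c.density τ s : ℝ) : ℂ) * c.phase τ s)) := by
    intro s
    change (F s * c.density τ s) • hillMatrix (c.position τ s) (1, 0) = _
    rw [hillMatrix_apply, Prod.smul_mk, Complex.real_smul, Complex.real_smul]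
    simp only [phase, mul_one, mul_zero, add_zero]
    ext1 <;> simp only <;> ring
  have hi := (c.continuous_coefficient_apply hF τ (1, 0)).intervalIntegrable
    (μ := MeasureTheory.volume) 0 Real.pi
  rw [← c.integral_mul_density hF, ← c.integral_mul_density_phase hF,
    ← intervalIntegral.integral_ofReal, ← intervalIntegral.integral_const_mul,
    ← intervalIntegral.integral_const_mul]
  change ∫ s in 0..Real.pi, c.coefficient hF τ s (1, 0) = _
  ext1
  · rw [← ContinuousLinearMap.coe_fst' (R := ℝ) (M₁ := ℂ) (M₂ := ℂ),
      ← ContinuousLinearMap.intervalIntegral_comp_comm _ hi]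
    simp only [h, ContinuousLinearMap.coe_fst']
  · rw [← ContinuousLinearMap.coe_snd' (R := ℝ) (M₁ := ℂ) (M₂ := ℂ),
      ← ContinuousLinearMap.intervalIntegral_comp_comm _ hi]
    simp only [h, ContinuousLinearMap.coe_snd']

theorem integral_norm_coefficient_le (hε : 0 ≤ ε) (hε1 : ε ≤ 1) (hF : Continuous F)
    (hK : ∀ s ∈ Set.Icc 0 Real.pi, |F s| ≤ K) (hK0 : 0 ≤ K) :
    ∫ s in 0..Real.pi, 1 / 2 * (2 * ε * (|F s| * ∑ i, c.b i s) + |F s| * (ε ^ 2 + c.β s)) ≤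
      ε * (4 + (K * Real.pi + 4) / 2) := by
  rw [intervalIntegral.integral_const_mul]
  have h1 := c.integral_major_le hF hK
  have h2 : 0 ≤ K * Real.pi + 4 := by positivity
  have h3 : ε ^ 2 * (K * Real.pi + 4) ≤ ε * (K * Real.pi + 4) :=
    mul_le_mul_of_nonneg_right (by nlinarith) h2
  linarith

theorem integral_norm_coefficient_sub_le (hε : 0 ≤ ε) (hε1 : ε ≤ 1) (hF : Continuous F)
    (hK : ∀ s ∈ Set.Icc 0 Real.pi, |F s| ≤ K) (hK0 : 0 ≤ K) {r : ℝ} (hr : 0 ≤ r) :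
    ∫ s in 0..Real.pi, r * (1 / 2 * (ε * (|F s| * ∑ i, c.b i s) + ε * m * (|F s| * c.β s)) +
        5 / 2 * ε * m * (2 * ε * (|F s| * ∑ i, c.b i s) + |F s| * (ε ^ 2 + c.β s))) ≤
      ε * (2 + 2 * m + 5 / 2 * m * (8 + (K * Real.pi + 4))) * r := by
  rw [intervalIntegral.integral_const_mul, intervalIntegral.integral_add
    ((continuous_const.fun_mul (c.continuous_minor hF)).intervalIntegrable _ _)
    ((continuous_const.fun_mul (c.continuous_major hF)).intervalIntegrable _ _),
    intervalIntegral.integral_const_mul, intervalIntegral.integral_const_mul]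
  have hm := c.mass_nonneg
  have h1 := c.integral_minor_le hε hF
  have h2 := mul_le_mul_of_nonneg_left (c.integral_major_le hF hK)
    (by positivity : 0 ≤ 5 / 2 * ε * m)
  have h3 : 0 ≤ K * Real.pi + 4 := by positivity
  have e2 : ε ^ 2 ≤ ε := by nlinarith
  have e3 : ε ^ 3 ≤ ε := by nlinarith [mul_nonneg hε (sub_nonneg.2 e2)]
  have h4 := mul_le_mul_of_nonneg_left e3 hm
  have h5 : 5 / 2 * ε * m * (8 * ε + ε ^ 2 * (K * Real.pi + 4)) ≤
      5 / 2 * ε * m * (8 + (K * Real.pi + 4)) := by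
    refine mul_le_mul_of_nonneg_left ?_ (by positivity)
    have := mul_le_mul_of_nonneg_right (e2.trans hε1) h3
    linarith
  rw [mul_comm]
  refine mul_le_mul_of_nonneg_right ?_ hr
  linarith

/-- For a suitable parameter the solution of Hill's equation has the same values at `0` and `π`. -/
theorem exists_parameter (hF : Continuous F) (hε : 0 < ε) (hε1 : ε ≤ 1)
    (hεm : ε * (Real.pi + 2 * m) ≤ Real.pi) (hK : ∀ s ∈ Set.Icc 0 Real.pi, |F s| ≤ K)
    (hK0 : 0 ≤ K) (ha : ε * (4 + (K * Real.pi + 4) / 2) ≤ 1 / 16)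
    (hLip : ε * (4 * m + 10 * m * (K * Real.pi + 4) + (6 * (2 * Real.pi + 4 * m) + 80 * m) +
      24 * (4 + (K * Real.pi + 4) / 2) *
        (2 + 2 * m + 5 / 2 * m * (8 + (K * Real.pi + 4)))) ≤ 1 / 2)
    (hbd : ε * (K * Real.pi + 4 + 16 * (2 * Real.pi + 4 * m) +
      8 * (4 + (K * Real.pi + 4) / 2) ^ 2) ≤ 1 / 2) :
    ∃ τ : ℝ × ℂ, ‖τ‖ ≤ 1 ∧ ∃ V : C(Set.Icc 0 Real.pi, ℂ × ℂ),
      V = ContinuousMap.const _ (1, 0) + volterra Real.pi_pos.le (c.coefficient hF τ) V ∧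
      ‖V - ContinuousMap.const _ (1, 0)‖ ≤ 1 / 8 ∧
      V ⟨Real.pi, Set.right_mem_Icc.2 Real.pi_pos.le⟩ = (1, 0) := by
  have hm := c.mass_nonneg
  set N := K * Real.pi + 4 with hN
  have hN0 : 0 ≤ N := by positivity
  set a := 4 + N / 2 with ha'
  set b := 2 + 2 * m + 5 / 2 * m * (8 + N) with hb'
  have hv : ‖((1, 0) : ℂ × ℂ)‖ ≤ 1 := by simp [Prod.norm_def]
  have cD : Continuous fun s =>
      1 / 2 * (2 * ε * (|F s| * ∑ i, c.b i s) + |F s| * (ε ^ 2 + c.β s)) :=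
    continuous_const.fun_mul (c.continuous_major hF)
  have iD := c.integral_norm_coefficient_le hε.le hε1 hF hK hK0
  rw [← hN, ← ha'] at iD
  have hA : ∀ τ : ℝ × ℂ, ‖τ‖ ≤ 1 → ∀ s ∈ Set.Icc 0 Real.pi, ‖c.coefficient hF τ s‖ ≤
      1 / 2 * (2 * ε * (|F s| * ∑ i, c.b i s) + |F s| * (ε ^ 2 + c.β s)) := fun τ hτ s _ =>
    c.norm_coefficient_le hF hε.le hε1 hεm hτ s
  have hsol : ∀ τ : ℝ × ℂ, ∃ V : C(Set.Icc 0 Real.pi, ℂ × ℂ), ‖τ‖ ≤ 1 →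
      V = ContinuousMap.const _ (1, 0) + volterra Real.pi_pos.le (c.coefficient hF τ) V := by
    intro τ
    by_cases hτ : ‖τ‖ ≤ 1
    · obtain ⟨V, hV⟩ := exists_eq_const_add_volterra Real.pi_pos.le cD (hA τ hτ) iD
        (by linarith) (1, 0)
      exact ⟨V, fun _ => hV⟩
    -- A junk value outside the unit ball, so that `V` is defined for every `τ`.
    · exact ⟨0, fun h => absurd h hτ⟩
  choose V hV using hsol
  have hclose : ∀ τ : ℝ × ℂ, ‖τ‖ ≤ 1 → ‖V τ - ContinuousMap.const _ (1, 0)‖ ≤ 2 * (ε * a) :=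
    fun τ hτ => (norm_le_of_eq_const_add_volterra Real.pi_pos.le cD (hA τ hτ) iD (by linarith) hv
      (hV τ hτ)).2
  set P : Set.Icc 0 Real.pi := ⟨Real.pi, Set.right_mem_Icc.2 Real.pi_pos.le⟩ with hP
  -- `W` is what remains of the value at π beyond the first Picard correction; it is of second order
  -- in ε.
  set W : ℝ × ℂ → ℂ × ℂ := fun τ => volterra Real.pi_pos.le (c.coefficient hF τ)
    (V τ - ContinuousMap.const _ (1, 0)) P with hW
  have hWsub : ∀ τ σ : ℝ × ℂ, ‖τ‖ ≤ 1 → ‖σ‖ ≤ 1 →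
      ‖W τ - W σ‖ ≤ 6 * (ε * a) * (ε * b * ‖τ - σ‖) := by
    intro τ σ hτ hσ
    have cD' : Continuous fun s => ‖τ - σ‖ *
        (1 / 2 * (ε * (|F s| * ∑ i, c.b i s) + ε * m * (|F s| * c.β s)) +
        5 / 2 * ε * m * (2 * ε * (|F s| * ∑ i, c.b i s) + |F s| * (ε ^ 2 + c.β s))) :=
      continuous_const.fun_mul ((continuous_const.fun_mul (c.continuous_minor hF)).fun_add
        (continuous_const.fun_mul (c.continuous_major hF)))
    have h := norm_volterra_sub_le Real.pi_pos.le cD cD' (hA τ hτ) (hA σ hσ)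
      (fun s hs => c.norm_coefficient_sub_le hF hε.le hε1 hεm τ hσ hs) iD
      (c.integral_norm_coefficient_sub_le hε.le hε1 hF hK hK0 (norm_nonneg (τ - σ)))
      (by linarith) hv (hV τ hτ) (hV σ hσ)
    exact (ContinuousMap.norm_coe_le_norm _ P).trans h
  have hW0 : ‖W 0‖ ≤ ε * a * (2 * (ε * a)) := by
    have h0 : ‖(0 : ℝ × ℂ)‖ ≤ 1 := by simp
    refine (ContinuousMap.norm_coe_le_norm _ P).trans
      ((norm_volterra_le Real.pi_pos.le cD (hA 0 h0) iD _).trans ?_)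
    exact mul_le_mul_of_nonneg_left (hclose 0 h0) (by positivity)
  -- The factors 4 and 4I undo the factors I/4 and -I/4 of the first correction, so that Im α = 0
  -- and β = 0 at π become `ε • τ + err τ = 0`.
  set err : ℝ × ℂ → ℝ × ℂ := fun τ =>
    (c.meanError τ + 4 * (W τ).1.im, c.fourierError τ + 4 * Complex.I * (W τ).2) with herr
  have herrsub : ∀ τ σ : ℝ × ℂ, ‖τ‖ ≤ 1 → ‖σ‖ ≤ 1 → ‖err τ - err σ‖ ≤ ε ^ 2 *
      (4 * m + 10 * m * N + (6 * (2 * Real.pi + 4 * m) + 80 * m) + 24 * a * b) * ‖τ - σ‖ := by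
    intro τ σ hτ hσ
    have h1 := hWsub τ σ hτ hσ
    have h2 := norm_fst_le (W τ - W σ)
    have h3 := norm_snd_le (W τ - W σ)
    have h4 := Complex.abs_im_le_norm ((W τ).1 - (W σ).1)
    have e3 : ε ^ 3 ≤ ε ^ 2 := by nlinarith [sq_nonneg ε]
    have g1 := mul_le_mul_of_nonneg_right e3 (mul_nonneg hm (norm_nonneg (τ - σ)))
    have g2 := mul_le_mul_of_nonneg_right e3
      (mul_nonneg (mul_nonneg hm hN0) (norm_nonneg (τ - σ)))
    have g3 : 0 ≤ ε ^ 2 * (10 * m * N + (6 * (2 * Real.pi + 4 * m) + 80 * m)) * ‖τ - σ‖ := by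
      positivity
    rw [herr, Prod.mk_sub_mk, Prod.norm_mk]
    refine max_le ?_ ?_
    · have h5 := c.abs_meanError_sub_le hε.le hF τ σ
      rw [show c.meanError τ + 4 * (W τ).1.im - (c.meanError σ + 4 * (W σ).1.im) =
        (c.meanError τ - c.meanError σ) + 4 * ((W τ).1 - (W σ).1).im by
          rw [Complex.sub_im]; ring]
      refine (norm_add_le _ _).trans ?_
      rw [norm_mul, Real.norm_eq_abs, Real.norm_eq_abs, Real.norm_eq_abs,
        abs_of_pos (by norm_num : (0 : ℝ) < 4)]
      simp only [Prod.fst_sub] at h2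
      linarith
    · have h5 := c.norm_fourierError_sub_le hε.le hε1 hεm hF hK hτ hσ
      rw [← hN] at h5
      rw [show c.fourierError τ + 4 * Complex.I * (W τ).2 -
        (c.fourierError σ + 4 * Complex.I * (W σ).2) =
        (c.fourierError τ - c.fourierError σ) + 4 * Complex.I * ((W τ).2 - (W σ).2) by ring]
      refine (norm_add_le _ _).trans ?_
      have h6 : ‖(4 * Complex.I : ℂ)‖ = 4 := by simp
      rw [norm_mul, h6]
      simp only [Prod.snd_sub] at h3
      linarith
  have herr0 : ‖err 0‖ ≤ ε ^ 2 * (N + 16 * (2 * Real.pi + 4 * m) + 8 * a ^ 2) := by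
    have h0 : ‖(0 : ℝ × ℂ)‖ ≤ 1 := by simp
    have h2 := norm_fst_le (W 0)
    have h3 := norm_snd_le (W 0)
    have h4 := Complex.abs_im_le_norm (W 0).1
    have g : 0 ≤ ε ^ 2 * (16 * (2 * Real.pi + 4 * m)) := by positivity
    rw [herr, Prod.norm_mk]
    refine max_le ?_ ?_
    · refine (norm_add_le _ _).trans ?_
      have h5 := c.abs_meanError_le hε.le hε1 hεm hF hK h0
      rw [← hN] at h5
      rw [norm_mul, Real.norm_eq_abs, Real.norm_eq_abs, Real.norm_eq_abs,
        abs_of_pos (by norm_num : (0 : ℝ) < 4)]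
      linarith
    · refine (norm_add_le _ _).trans ?_
      have h5 := c.norm_fourierError_le hε.le hε1 hεm hF hK h0
      rw [← hN] at h5
      have h6 : ‖(4 * Complex.I : ℂ)‖ = 4 := by simp
      rw [norm_mul, h6]
      linarith
  have hcancel : ∀ x : ℝ, ε⁻¹ * (ε ^ 2 * x) = ε * x := fun x => by field_simp
  -- Since `err` and its Lipschitz constant are O(ε²), dividing by ε leaves O(ε), at most 1/2 by
  -- `hbd` and `hLip`.
  obtain ⟨τ, hτ, hfix⟩ := exists_add_eq_zero_of_lipschitz (f := fun τ => ε⁻¹ • err τ)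
    (by
      intro τ σ hτ hσ
      rw [← smul_sub, norm_smul, Real.norm_eq_abs, abs_of_pos (inv_pos.2 hε)]
      refine (mul_le_mul_of_nonneg_left (herrsub τ σ hτ hσ) (inv_pos.2 hε).le).trans ?_
      rw [mul_assoc (ε ^ 2), hcancel, ← mul_assoc]
      exact mul_le_mul_of_nonneg_right hLip (norm_nonneg _))
    (by
      rw [norm_smul, Real.norm_eq_abs, abs_of_pos (inv_pos.2 hε)]
      refine (mul_le_mul_of_nonneg_left herr0 (inv_pos.2 hε).le).trans ?_
      rw [hcancel]
      exact hbd)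
  have hfix' : ε • τ + err τ = 0 := by
    have := congrArg (fun x => ε • x) hfix
    simpa [smul_smul, hε.ne'] using this
  have hfix1 : ε * τ.1 + (c.meanError τ + 4 * (W τ).1.im) = 0 := congrArg Prod.fst hfix'
  have hfix2 : (ε : ℂ) * τ.2 + (c.fourierError τ + 4 * Complex.I * (W τ).2) = 0 := by
    rw [← Complex.real_smul]
    exact congrArg Prod.snd hfix'
  have hval : V τ P = (1, 0) + ((Complex.I / 4 * ((ε * τ.1 + c.meanError τ : ℝ) : ℂ),
        -(Complex.I / 4) * (ε * τ.2 + c.fourierError τ)) + W τ) := by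
    have h1 : V τ P = (1, 0) + volterra Real.pi_pos.le (c.coefficient hF τ) (V τ) P :=
      congrArg (fun U : C(Set.Icc 0 Real.pi, ℂ × ℂ) => U P) (hV τ hτ)
    simp only [hW]
    rw [h1, volterra_sub_right, ContinuousMap.sub_apply, ← c.volterra_coefficient_const hF τ,
      add_sub_cancel]
  have hval1 : (V τ P).1.im = 0 := by
    rw [hval]
    simp
    linarith
  have hval2 : (V τ P).2 = 0 := by
    rw [hval]
    simp only [Prod.snd_add]
    have hI := Complex.I_mul_I
    linear_combination (-(Complex.I / 4)) * hfix2 + (W τ).2 * hI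
  -- With β = 0 and α real the conserved form gives α² = 1, and closeness to 1 excludes α = -1.
  have hform := form_eq_one_of_volterra (A := c.coefficient hF τ) (fun _ => rfl) Real.pi_pos
    (hV τ hτ) P
  rw [hval2, map_zero, sub_zero, Complex.normSq_apply, hval1] at hform
  have hcl : ‖V τ - ContinuousMap.const _ (1, 0)‖ ≤ 1 / 8 := (hclose τ hτ).trans (by linarith)
  have hre : |(V τ P).1.re - 1| ≤ 1 / 8 := by
    have h1 := (norm_fst_le _).trans ((ContinuousMap.norm_coe_le_norm
      (V τ - ContinuousMap.const _ (1, 0)) P).trans hcl)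
    have h2 := (Complex.abs_re_le_norm _).trans h1
    simpa using h2
  refine ⟨τ, hτ, V τ, hV τ hτ, hcl, ?_⟩
  have h1 : (V τ P).1.re = 1 := by nlinarith [abs_le.1 hre]
  exact Prod.ext (Complex.ext h1 hval1) hval2

end BumpConfig

/-- A reparametrization `ψ` of the circle `ℝ / πℤ` for which Hill's equation with the potential
`F ∘ ψ⁻¹` has only solutions that are antiperiodic, with a solution close to `e^{ix}`. -/
theorem exists_reparametrization {F : ℝ → ℝ} (hF : Continuous F)
    (hper : Function.Periodic F Real.pi) {p₂ p₃ p₄ : ℝ} (h2 : 0 < p₂) (h23 : p₂ < p₃)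
    (h34 : p₃ < p₄) (h4 : p₄ < Real.pi) (f1 : 0 < F 0) (f2 : F p₂ < 0) (f3 : 0 < F p₃)
    (f4 : F p₄ < 0) :
    ∃ (ρ ψ : ℝ → ℝ) (U : ℝ → ℂ × ℂ), ContDiff ℝ ∞ ρ ∧ (∀ s, 0 < ρ s) ∧
      (∀ s, HasDerivAt ψ (ρ s) s) ∧ (∀ s, ψ (s + Real.pi) = ψ s + Real.pi) ∧
      Function.Periodic U Real.pi ∧
      (∀ s, HasDerivAt U ((F s * ρ s) • hillMatrix (ψ s) (U s)) s) ∧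
      (∀ s, ‖U s - (1, 0)‖ ≤ 1 / 8) ∧
      ∀ s, Complex.normSq (U s).1 - Complex.normSq (U s).2 = 1 := by
  obtain ⟨m, hm⟩ := exists_bumpConfig hF hper h2 h23 h34 h4 f1 f2 f3 f4
  obtain ⟨K, hK⟩ := isCompact_Icc.exists_bound_of_continuousOn (s := Set.Icc 0 Real.pi)
    hF.continuousOn
  have hK0 : 0 ≤ K := (norm_nonneg _).trans (hK 0 ⟨le_rfl, Real.pi_pos.le⟩)
  have small : ∀ C d : ℝ, 0 < d → ∀ᶠ ε in nhdsWithin (0 : ℝ) (Set.Ioi 0), ε * C ≤ d := by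
    intro C d hd
    have : ∀ᶠ ε in nhds (0 : ℝ), ε * C < d := by
      apply (continuous_id.mul continuous_const).continuousAt.eventually (gt_mem_nhds _)
      simpa using hd
    exact (this.mono fun _ h => h.le).filter_mono nhdsWithin_le_nhds
  -- Each condition has the form ε C ≤ d with C depending only on `K` and `m`, so all hold for small
  -- ε.
  obtain ⟨ε, hε, hε1, hεm, ha, hLip, hbd⟩ := ((eventually_mem_nhdsWithin (a := (0 : ℝ))
    (s := Set.Ioi 0)).and ((small 1 1 one_pos).and ((small _ _ Real.pi_pos).and
    ((small _ (1 / 16) (by norm_num)).and ((small _ (1 / 2) (by norm_num)).and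
    (small _ (1 / 2) (by norm_num))))))).exists
  rw [mul_one] at hε1
  obtain ⟨c⟩ := hm ε hε
  obtain ⟨τ, hτ, V, hV, hcl, hVpi⟩ := c.exists_parameter hF hε hε1 hεm hK hK0 ha hLip hbd
  have hAper : Function.Periodic (c.coefficient hF τ) Real.pi := by
    intro s
    change (F (s + Real.pi) * c.density τ (s + Real.pi)) •
      hillMatrix (c.position τ (s + Real.pi)) = (F s * c.density τ s) • hillMatrix (c.position τ s)
    rw [hper s, c.periodic_density τ s, c.position_add_pi, hillMatrix_add_pi]
  obtain ⟨U, hU1, -, hU3, hU4⟩ := exists_periodic_extension Real.pi_pos hAper hV hVpi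
  refine ⟨c.density τ, c.position τ, U, c.contDiff_density τ, c.density_pos hε hε1 hεm hτ,
    c.hasDerivAt_position τ, c.position_add_pi τ, hU1, hU3, fun s => ?_, fun s => ?_⟩
  · obtain ⟨t, ht⟩ := hU4 s
    rw [ht]
    exact (ContinuousMap.norm_coe_le_norm (V - ContinuousMap.const _ (1, 0)) t).trans hcl
  · obtain ⟨t, ht⟩ := hU4 s
    rw [ht]
    exact form_eq_one_of_volterra (A := c.coefficient hF τ) (fun _ => rfl) Real.pi_pos hV t

/-! ### From antiperiodic solutions of Hill's equation to diffeomorphisms. -/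

/-- The inverse of a smooth map with positive derivative commuting with the translation by `π`. -/
theorem exists_smooth_inverse {ρ ψ : ℝ → ℝ} (hρ : ContDiff ℝ ∞ ρ) (hpos : ∀ s, 0 < ρ s)
    (hψ : ∀ s, HasDerivAt ψ (ρ s) s) (hper : ∀ s, ψ (s + Real.pi) = ψ s + Real.pi) :
    ∃ φ : ℝ → ℝ, ContDiff ℝ ∞ φ ∧ (∀ x, HasDerivAt φ (ρ (φ x))⁻¹ x) ∧ (∀ x, ψ (φ x) = x) ∧
      ∀ x, φ (x + Real.pi) = φ x + Real.pi := by
  have hd : deriv ψ = ρ := funext fun s => (hψ s).deriv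
  have hsm : ContDiff ℝ ∞ ψ := by
    rw [contDiff_infty_iff_deriv]
    exact ⟨fun s => (hψ s).differentiableAt, hd ▸ hρ⟩
  have hbij := bijective_of_deriv_pos hsm (fun s => by rw [hd]; exact hpos s) hper
  have hmono : StrictMono ψ := strictMono_of_deriv_pos fun s => by rw [hd]; exact hpos s
  let e : ℝ ≃o ℝ := hmono.orderIsoOfSurjective ψ hbij.2
  have he : ∀ s, e s = ψ s := fun s => rfl
  have hψφ : ∀ x, ψ (e.symm x) = x := fun x => e.apply_symm_apply x
  have hφd : ∀ x, HasDerivAt e.symm (ρ (e.symm x))⁻¹ x := fun x =>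
    HasDerivAt.of_local_left_inverse e.symm.continuous.continuousAt (hψ _) (hpos _).ne'
      (Filter.Eventually.of_forall hψφ)
  refine ⟨e.symm, ?_, hφd, hψφ, fun x => ?_⟩
  -- Regularity is bootstrapped from φ' = 1 / ρ(φ).
  · rw [contDiff_infty]
    intro n
    induction n with
    | zero => exact contDiff_zero.2 e.symm.continuous
    | succ n ih =>
      have hd' : deriv (e.symm : ℝ → ℝ) = fun x => (ρ (e.symm x))⁻¹ :=
        funext fun x => (hφd x).deriv
      rw [show ((n + 1 : ℕ) : WithTop ℕ∞) = (n : WithTop ℕ∞) + 1 by push_cast; rfl,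
        contDiff_succ_iff_deriv]
      refine ⟨fun x => (hφd x).differentiableAt, by simp, ?_⟩
      rw [hd']
      exact ((hρ.of_le (by exact_mod_cast le_top)).comp ih).inv fun x => (hpos _).ne'
  · apply hbij.1
    rw [hψφ, hper, hψφ]

/-- Bootstrapping: z' = w and w' = -(1 + q/2) z raise the regularity of both functions by one at
each step. -/
theorem contDiff_of_hill {q : ℝ → ℝ} (hq : ContDiff ℝ ∞ q) {z w : ℝ → ℂ}
    (hz : ∀ x, HasDerivAt z (w x) x)
    (hw : ∀ x, HasDerivAt w (-(((1 + q x / 2 : ℝ) : ℂ) * z x)) x) : ContDiff ℝ ∞ z := by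
  have hq' : ContDiff ℝ ∞ fun x => ((1 + q x / 2 : ℝ) : ℂ) :=
    Complex.ofRealCLM.contDiff.comp (contDiff_const.add (hq.div_const 2))
  have key : ∀ n : ℕ, ContDiff ℝ n z ∧ ContDiff ℝ n w := by
    intro n
    induction n with
    | zero =>
      exact ⟨contDiff_zero.2 (continuous_iff_continuousAt.2 fun x => (hz x).continuousAt),
        contDiff_zero.2 (continuous_iff_continuousAt.2 fun x => (hw x).continuousAt)⟩
    | succ n ih =>
      have dz : deriv z = w := funext fun x => (hz x).deriv
      have dw : deriv w = fun x => -(((1 + q x / 2 : ℝ) : ℂ) * z x) := funext fun x => (hw x).deriv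
      rw [show ((n + 1 : ℕ) : WithTop ℕ∞) = (n : WithTop ℕ∞) + 1 by push_cast; rfl,
        contDiff_succ_iff_deriv, contDiff_succ_iff_deriv, dz, dw]
      exact ⟨⟨fun x => (hz x).differentiableAt, by simp, ih.2⟩, fun x => (hw x).differentiableAt,
        by simp, ((hq'.of_le (by exact_mod_cast le_top)).mul ih.1).neg⟩
  exact contDiff_infty.2 fun n => (key n).1

/-- An antiperiodic complex solution of Hill's equation `z'' + (1 + q / 2) z = 0` that turns by less
than `2π` over a period defines a diffeomorphism of the projective line whose Schwarzian derivative
is the potential `q`. -/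
theorem exists_diffeo_of_hill {q : ℝ → ℝ} (hq : ContDiff ℝ ∞ q) {z w : ℝ → ℂ}
    (hz : ∀ x, HasDerivAt z (w x) x)
    (hw : ∀ x, HasDerivAt w (-(((1 + q x / 2 : ℝ) : ℂ) * z x)) x)
    (hanti : ∀ x, z (x + Real.pi) = -z x)
    (hwr : ∀ x, (z x).re * (w x).im - (z x).im * (w x).re = 1)
    (hbig : ∀ x, 1 / 2 < Complex.normSq (z x)) :
    ∃ g : RP1 ≃ RP1, IsOrientationPreservingDiffeo g ∧ ∀ x, schwarzian g (angle x) = q x := by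
  have hzsm := contDiff_of_hill hq hz hw
  have du : ∀ x, HasDerivAt (fun x => (z x).re) (w x).re x := fun x =>
    Complex.reCLM.hasFDerivAt.comp_hasDerivAt x (hz x)
  have dv : ∀ x, HasDerivAt (fun x => (z x).im) (w x).im x := fun x =>
    Complex.imCLM.hasFDerivAt.comp_hasDerivAt x (hz x)
  have du' : ∀ x, HasDerivAt (fun x => (w x).re) (-((1 + q x / 2) * (z x).re)) x := fun x => by
    have := Complex.reCLM.hasFDerivAt.comp_hasDerivAt x (hw x)
    refine this.congr_deriv ?_
    simp only [Complex.reCLM_apply, Complex.neg_re, Complex.re_ofReal_mul]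
  have dv' : ∀ x, HasDerivAt (fun x => (w x).im) (-((1 + q x / 2) * (z x).im)) x := fun x => by
    have := Complex.imCLM.hasFDerivAt.comp_hasDerivAt x (hw x)
    refine this.congr_deriv ?_
    simp only [Complex.imCLM_apply, Complex.neg_im, Complex.im_ofReal_mul]
  set r : ℝ → ℝ := fun x => (z x).re * (z x).re + (z x).im * (z x).im with hr
  have hr2 : ∀ x, 1 / 2 < r x := fun x => by
    have := hbig x
    rwa [Complex.normSq_apply] at this
  have hr0 : ∀ x, 0 < r x := fun x => by linarith [hr2 x]
  set s : ℝ → ℝ := fun x => (z x).re * (w x).re + (z x).im * (w x).im with hs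
  have dr : ∀ x, HasDerivAt r (2 * s x) x := fun x =>
    (((du x).fun_mul (du x)).fun_add ((dv x).fun_mul (dv x))).congr_deriv (by simp only [hs]; ring)
  have ds : ∀ x, HasDerivAt s ((w x).re ^ 2 + (w x).im ^ 2 - (1 + q x / 2) * r x) x := fun x =>
    (((du x).fun_mul (du' x)).fun_add ((dv x).fun_mul (dv' x))).congr_deriv
      (by simp only [hr]; ring)
  set p : ℝ → ℝ := fun x => (r x)⁻¹ with hp
  have hp0 : ∀ x, 0 < p x := fun x => inv_pos.2 (hr0 x)
  have dp : ∀ x, HasDerivAt p (-(2 * s x) / r x ^ 2) x := fun x => (dr x).fun_inv (hr0 x).ne'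
  have hrsm : ContDiff ℝ ∞ r :=
    (((Complex.reCLM.contDiff.comp hzsm).mul (Complex.reCLM.contDiff.comp hzsm)).add
      ((Complex.imCLM.contDiff.comp hzsm).mul (Complex.imCLM.contDiff.comp hzsm)))
  have hpsm : ContDiff ℝ ∞ p := hrsm.inv fun x => (hr0 x).ne'
  have hpc : Continuous p := hpsm.continuous
  -- Wronskian 1 means that the argument of z has derivative 1 / |z|², so `G` is this argument up to
  -- a constant.
  set G : ℝ → ℝ := fun x => ∫ t in 0..x, p t with hG
  have dG : ∀ x, HasDerivAt G (p x) x := fun x =>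
    intervalIntegral.integral_hasDerivAt_right (hpc.intervalIntegrable _ _)
      (hpc.stronglyMeasurableAtFilter _ _) hpc.continuousAt
  have hdG : deriv G = p := funext fun x => (dG x).deriv
  have hGsm : ContDiff ℝ ∞ G := by
    rw [contDiff_infty_iff_deriv, hdG]
    exact ⟨fun x => (dG x).differentiableAt, hpsm⟩
  have hpper : Function.Periodic p Real.pi := fun x => by
    simp only [hp, hr, hanti, Complex.neg_re, Complex.neg_im, neg_mul_neg]
  have hGpi : G Real.pi = Real.pi := by
    -- `H` is (z / |z|)² e^{-2iG}. Its constancy identifies `G` with the argument without choosing a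
    -- branch, and antiperiodicity of z then puts G π in πℤ.
    set H : ℝ → ℂ := fun x =>
      z x * z x * (p x : ℂ) * Complex.exp (-(2 * (G x : ℂ) * Complex.I)) with hH
    have dH : ∀ x, HasDerivAt H 0 x := by
      intro x
      have e1 : HasDerivAt (fun x => (p x : ℂ)) ((-(2 * s x) / r x ^ 2 : ℝ) : ℂ) x :=
        (dp x).ofReal_comp
      have e2 : HasDerivAt (fun x => (G x : ℂ)) ((p x : ℝ) : ℂ) x := (dG x).ofReal_comp
      have e3 := (((hz x).fun_mul (hz x)).fun_mul e1).fun_mul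
        (((e2.const_mul 2).mul_const Complex.I).fun_neg.cexp)
      refine e3.congr_deriv ?_
      have hrc : (r x : ℂ) ≠ 0 := by exact_mod_cast (hr0 x).ne'
      -- This is w z̄ = s + I, whose imaginary part is the Wronskian, multiplied by z.
      have hrel : w x * (r x : ℂ) = ((s x : ℂ) + Complex.I) * z x := by
        have := hwr x
        apply Complex.ext
        · simp [hr, hs]
          linear_combination -(z x).im * this
        · simp [hr, hs]
          linear_combination (z x).re * this
      have hpc : (p x : ℂ) = (r x : ℂ)⁻¹ := by simp [hp]
      rw [hpc]
      push_cast
      field_simp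
      linear_combination (2 * Complex.exp (-(2 * (G x : ℂ) * Complex.I)) * z x) * hrel
    have hconst : H Real.pi = H 0 :=
      is_const_of_deriv_eq_zero (fun x => (dH x).differentiableAt) (fun x => (dH x).deriv) _ _
    have hG0 : G 0 = 0 := by simp [hG]
    have hzpi : z Real.pi = -z 0 := by simpa using hanti 0
    have hppi : p Real.pi = p 0 := by simpa using hpper 0
    have hz0 : z 0 ≠ 0 := by
      intro h
      have := hbig 0
      rw [h, map_zero] at this
      norm_num at this
    have hexp : Complex.exp (-(2 * (G Real.pi : ℂ) * Complex.I)) = 1 := by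
      have hp0' : (p 0 : ℂ) ≠ 0 := by exact_mod_cast (hp0 0).ne'
      simp only [hH, hzpi, hppi, hG0, neg_mul_neg] at hconst
      simp only [Complex.ofReal_zero, mul_zero, zero_mul, neg_zero, Complex.exp_zero] at hconst
      exact mul_left_cancel₀ (mul_ne_zero (mul_ne_zero hz0 hz0) hp0') hconst
    obtain ⟨n, hn⟩ := Complex.exp_eq_one_iff.1 hexp
    have hn' : G Real.pi = -n * Real.pi := by
      have := congrArg Complex.im hn
      simp at this
      linarith
    have hpos : 0 < G Real.pi :=
      intervalIntegral.intervalIntegral_pos_of_pos (hpc.intervalIntegrable _ _) hp0 Real.pi_pos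
    -- Here |z|² > 1/2 enters: the integrand is below 2, so the only possible multiple of π is π
    -- itself.
    have hlt : G Real.pi < 2 * Real.pi := by
      have h1 : ∫ x in 0..Real.pi, p x < ∫ _x in 0..Real.pi, (2 : ℝ) := by
        refine intervalIntegral.integral_lt_integral_of_continuousOn_of_le_of_exists_lt Real.pi_pos
          hpc.continuousOn continuousOn_const (fun x _ => ?_) ⟨0, ⟨le_rfl, Real.pi_pos.le⟩, ?_⟩
        · exact (inv_le_comm₀ (hr0 x) two_pos).2 (by linarith [hr2 x])
        · exact (inv_lt_comm₀ (hr0 0) two_pos).2 (by linarith [hr2 0])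
      have h2 : ∫ _x in 0..Real.pi, (2 : ℝ) = 2 * Real.pi := by simp [mul_comm]
      exact h1.trans_eq h2
    rw [hn'] at hpos hlt
    have hn1 : (0 : ℝ) < -n := pos_of_mul_pos_left hpos Real.pi_pos.le
    have hn2 : (-n : ℝ) < 2 := lt_of_mul_lt_mul_right hlt Real.pi_pos.le
    have hn3 : -n = 1 := by
      have a1 : 0 < -n := by exact_mod_cast hn1
      have a2 : -n < 2 := by exact_mod_cast hn2
      omega
    rw [hn', show (-n : ℝ) = ((-n : ℤ) : ℝ) by push_cast; rfl, hn3]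
    simp
  have hGadd : ∀ x, G (x + Real.pi) = G x + Real.pi := by
    intro x
    have hi : ∀ a b, IntervalIntegrable p MeasureTheory.volume a b := fun a b =>
      hpc.intervalIntegrable a b
    have h := hGpi
    simp only [hG] at h ⊢
    rw [← intervalIntegral.integral_add_adjacent_intervals (hi 0 x) (hi x (x + Real.pi)),
      hpper.intervalIntegral_add_eq x 0, zero_add, h]
  obtain ⟨g, hg, hgG⟩ := exists_equiv_of_lift hGsm (fun x => by rw [hdG]; exact hp0 x) hGadd
  refine ⟨g, hg, fun x => ?_⟩
  have dp₁ : ∀ x, HasDerivAt (fun x => -(2 * s x) / r x ^ 2)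
      ((-(2 * ((w x).re ^ 2 + (w x).im ^ 2 - (1 + q x / 2) * r x)) * r x ^ 2 -
        -(2 * s x) * (2 * r x * (2 * s x))) / (r x ^ 2) ^ 2) x := fun x =>
    (((ds x).const_mul 2).fun_neg.fun_div ((dr x).fun_pow 2) (pow_pos (hr0 x) 2).ne').congr_deriv
      (by simp)
  rw [schwarzian_angle hgG dG dp dp₁ x (hp0 x).ne']
  have hrx := (hr0 x).ne'
  -- Lagrange's identity: the left side is the square of the Wronskian.
  have hkey : ((w x).re ^ 2 + (w x).im ^ 2) * r x - s x ^ 2 = 1 := by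
    have := hwr x
    simp only [hr, hs]
    linear_combination ((z x).re * (w x).im - (z x).im * (w x).re + 1) * this
  simp only [hp]
  field_simp
  linear_combination (-2) * hkey

theorem exists_diffeo_pullback_eq_schwarzian {F : ℝ → ℝ} (hF : ContDiff ℝ ∞ F)
    (hper : Function.Periodic F Real.pi) {p₂ p₃ p₄ : ℝ} (h2 : 0 < p₂) (h23 : p₂ < p₃)
    (h34 : p₃ < p₄) (h4 : p₄ < Real.pi) (f1 : 0 < F 0) (f2 : F p₂ < 0) (f3 : 0 < F p₃)
    (f4 : F p₄ < 0) :
    ∃ (φ : ℝ → ℝ) (g : RP1 ≃ RP1), ContDiff ℝ ∞ φ ∧ (∀ x, 0 < deriv φ x) ∧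
      (∀ x, φ (x + Real.pi) = φ x + Real.pi) ∧ IsOrientationPreservingDiffeo g ∧
      ∀ x, schwarzian g (angle x) = F (φ x) := by
  obtain ⟨ρ, ψ, U, hρ, hρ0, hψ, hψpi, hUper, hU, hUcl, hform⟩ :=
    exists_reparametrization hF.continuous hper h2 h23 h34 h4 f1 f2 f3 f4
  obtain ⟨φ, hφ, hφd, hψφ, hφpi⟩ := exists_smooth_inverse hρ hρ0 hψ hψpi
  set e : ℝ → ℂ := fun x => Complex.exp (x * Complex.I) with he
  set e' : ℝ → ℂ := fun x => Complex.exp (-(x * Complex.I)) with he'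
  have hee : ∀ x, e x * e' x = 1 := fun x => by
    simp only [he, he']
    rw [← Complex.exp_add, add_neg_cancel, Complex.exp_zero]
  have hsq : ∀ x : ℝ, Complex.exp (2 * x * Complex.I) = e x * e x := fun x => by
    simp only [he]
    rw [← Complex.exp_add]
    ring_nf
  have hconj : ∀ x, starRingEnd ℂ (e x) = e' x := fun x => by
    simp only [he, he']
    rw [← Complex.exp_conj]
    simp
  have hsq' : ∀ x : ℝ, starRingEnd ℂ (Complex.exp (2 * x * Complex.I)) = e' x * e' x := fun x => by
    rw [hsq, map_mul, hconj]
  have de : ∀ x, HasDerivAt e (Complex.I * e x) x := fun x => by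
    have := ((Complex.ofRealCLM.hasDerivAt (x := x)).mul_const Complex.I).cexp
    refine this.congr_deriv ?_
    simp [he, mul_comm]
  have de' : ∀ x, HasDerivAt e' (-Complex.I * e' x) x := fun x => by
    have := ((Complex.ofRealCLM.hasDerivAt (x := x)).mul_const Complex.I).fun_neg.cexp
    refine this.congr_deriv ?_
    simp [he', mul_comm]
  set q : ℝ → ℝ := fun x => F (φ x) with hq
  set α : ℝ → ℂ := fun x => (U (φ x)).1 with hα
  set β : ℝ → ℂ := fun x => (U (φ x)).2 with hβ
  -- The factor ρ of the reparametrized equation cancels against φ' = 1 / ρ(φ), leaving the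
  -- potential F ∘ φ in the variable x.
  have hUφ : ∀ x, HasDerivAt (fun x => U (φ x)) (q x • hillMatrix x (U (φ x))) x := by
    intro x
    refine ((hU (φ x)).scomp x (hφd x)).congr_deriv ?_
    rw [hψφ, smul_smul]
    congr 1
    have := (hρ0 (φ x)).ne'
    simp only [hq]
    field_simp
  have dα : ∀ x, HasDerivAt α (q x * (Complex.I / 4 * (α x + e' x * e' x * β x))) x := fun x =>
    ((ContinuousLinearMap.fst ℝ ℂ ℂ).hasFDerivAt.comp_hasDerivAt x (hUφ x)).congr_deriv (by
      rw [hillMatrix_apply, hsq', hsq]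
      simp [hα, hβ])
  have dβ : ∀ x, HasDerivAt β (q x * (-(Complex.I / 4) * (e x * e x * α x + β x))) x := fun x =>
    ((ContinuousLinearMap.snd ℝ ℂ ℂ).hasFDerivAt.comp_hasDerivAt x (hUφ x)).congr_deriv (by
      rw [hillMatrix_apply, hsq', hsq]
      simp [hα, hβ])
  have hI := Complex.I_mul_I
  have hz : ∀ x, HasDerivAt (fun x => α x * e x + β x * e' x)
      (Complex.I * (α x * e x - β x * e' x)) x := fun x =>
    (((dα x).fun_mul (de x)).fun_add ((dβ x).fun_mul (de' x))).congr_deriv (by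
      linear_combination (q x * Complex.I / 4 * (β x * e' x - α x * e x)) * hee x)
  have hw : ∀ x, HasDerivAt (fun x => Complex.I * (α x * e x - β x * e' x))
      (-(((1 + q x / 2 : ℝ) : ℂ) * (α x * e x + β x * e' x))) x := fun x =>
    ((((dα x).fun_mul (de x)).fun_sub ((dβ x).fun_mul (de' x))).const_mul Complex.I).congr_deriv (by
      push_cast
      linear_combination (q x * Complex.I * Complex.I / 4 * (β x * e' x + α x * e x)) * hee x +
        ((1 + q x / 2) * (α x * e x + β x * e' x)) * hI)
  have hne : ∀ x, ‖e x‖ = 1 := fun x => Complex.norm_exp_ofReal_mul_I x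
  have hne' : ∀ x, ‖e' x‖ = 1 := fun x => by
    have := congrArg norm (hee x)
    rwa [norm_mul, hne, one_mul, norm_one] at this
  have hepi : ∀ x, e (x + Real.pi) = -e x := fun x => by
    simp only [he]
    push_cast
    rw [add_mul, Complex.exp_add, Complex.exp_pi_mul_I]
    ring
  have hepi' : ∀ x, e' (x + Real.pi) = -e' x := fun x => by
    have h1 := hee (x + Real.pi)
    rw [hepi] at h1
    linear_combination (-e' x) * h1 - e' (x + Real.pi) * hee x
  have hUpi : ∀ x, U (φ (x + Real.pi)) = U (φ x) := fun x => by rw [hφpi, hUper]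
  obtain ⟨g, hg, hgS⟩ := exists_diffeo_of_hill (hF.comp hφ) hz hw
    (fun x => by
      simp only [hα, hβ, hUpi, hepi, hepi']
      ring)
    -- The Wronskian of z = α e^{ix} + β e^{-ix} is |α|² - |β|², the conserved form.
    (fun x => by
      have h1 := hform (φ x)
      have h2 : (e x).re * (e x).re + (e x).im * (e x).im = 1 := by
        rw [← Complex.normSq_apply, Complex.normSq_eq_norm_sq, hne, one_pow]
      have h3 : e' x = starRingEnd ℂ (e x) := (hconj x).symm
      rw [Complex.normSq_apply, Complex.normSq_apply] at h1
      rw [h3]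
      simp only [hα, hβ, Complex.add_re, Complex.add_im, Complex.sub_re, Complex.sub_im,
        Complex.mul_re, Complex.mul_im, Complex.I_re, Complex.I_im, Complex.conj_re,
        Complex.conj_im]
      linear_combination ((e x).re * (e x).re + (e x).im * (e x).im) * h1 + h2)
    -- Here |α| ≥ 7/8 and |β| ≤ 1/8 give |z| ≥ 3/4, and 9/16 > 1/2.
    (fun x => by
      have h1 := (norm_fst_le _).trans (hUcl (φ x))
      have h2 := (norm_snd_le _).trans (hUcl (φ x))
      rw [Prod.fst_sub] at h1
      rw [Prod.snd_sub, sub_zero] at h2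
      have h3 : 7 / 8 ≤ ‖α x‖ := by
        have := norm_sub_norm_le (1 : ℂ) (α x)
        rw [norm_one, norm_sub_rev] at this
        linarith
      have h4 : 3 / 4 ≤ ‖α x * e x + β x * e' x‖ := by
        have := norm_sub_le_norm_add (α x * e x) (β x * e' x)
        rw [norm_mul, norm_mul, hne, hne', mul_one, mul_one] at this
        linarith
      rw [Complex.normSq_eq_norm_sq]
      nlinarith)
  refine ⟨φ, g, hφ, fun x => ?_, hφpi, hg, hgS⟩
  rw [(hφd x).deriv]
  exact inv_pos.2 (hρ0 _)

end

end ConverseGhys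

/-! ### Descent to the projective line. -/

theorem theorem2 (f : ConverseGhys.RP1 → ℝ) (hf : ConverseGhys.IsSmooth f)
    (hsign : ConverseGhys.HasFourSignChanges f) :
    ∃ φ g : ConverseGhys.RP1 ≃ ConverseGhys.RP1,
      ConverseGhys.IsOrientationPreservingDiffeo φ ∧
      ConverseGhys.IsOrientationPreservingDiffeo g ∧
      ∀ p : ConverseGhys.RP1, f (φ p) = ConverseGhys.schwarzian g p := by
  obtain ⟨x₁, x₂, x₃, x₄, h12, h23, h34, h41, f1, f2, f3, f4⟩ := hsign
  -- The parameter is translated so that the first positive point lies at 0; the lift of φ below is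
  -- translated back by x₁.
  have hF : ContDiff ℝ ∞ fun s => f (ConverseGhys.angle (x₁ + s)) :=
    ContDiff.comp (g := fun x : ℝ => f (ConverseGhys.angle x)) hf (contDiff_const.add contDiff_id)
  obtain ⟨Φ, g, hΦ, hΦ0, hΦpi, hg, hgS⟩ :=
    ConverseGhys.exists_diffeo_pullback_eq_schwarzian hF
      (fun s => by simp only [← add_assoc, ConverseGhys.angle_add_pi])
      (sub_pos.2 h12) (sub_lt_sub_right h23 x₁) (sub_lt_sub_right h34 x₁) (by linarith)
      (by simpa using f1) (by simpa using f2) (by simpa using f3) (by simpa using f4)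
  obtain ⟨φ, hφ, hφΦ⟩ := ConverseGhys.exists_equiv_of_lift (Φ := fun x => x₁ + Φ x)
    (contDiff_const.add hΦ) (fun x => by rw [deriv_const_add]; exact hΦ0 x)
    (fun x => by simp only [hΦpi, add_assoc])
  refine ⟨φ, g, hφ, hg, fun p => ?_⟩
  obtain ⟨x, rfl⟩ := ConverseGhys.angle_surjective p
  rw [hφΦ, hgS]
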